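/- Let $\hbar,u_0\in\mathbb C$, $\hbar\neq 0$, and fix a square root $\hbar^{1/2}$ of $\hbar$. On the space $\mathbb C[q_1,q_2,\dots]$ let $\hat q_k$ be multiplication by $q_k$ and $\hat p_k=\hbar k\,\partial/\partial q_k$ for $k\ge 1$, and put $u(x)=u_0+\sum_{k\ge1}(\hat q_ke^{ikx}+\hat p_ke^{-ikx})$ and $s(t)=\frac{\sinh(t/2)}{t/2}$. Define operators $\hat H_k$, $k\ge-1$, on $\mathbb C[q_1,q_2,\dots]$ by the formal generating function $$\frac{1}{2\pi\, s(\hbar^{1/2}z)}:\int_0^{2\pi}e^{z\,s(i\hbar^{1/2}z\partial_x)u(x)}\,dx:\;=\;1+\sum_{k\ge-1}\hat H_kz^{k+2},$$ where the normal ordering $:\ :$ puts, in every monomial, all $\hat p$'s to the right of all $\hat q$'s. Define $h_k(q)$ by $\sum_{k\ge0}h_k(q)z^k=\exp\big(\sum_{k\ge1}q_kz^k/k\big)$ and $h_k=0$ for $k<0$. For a partition $\lambda=(\lambda_1\ge\dots\ge\lambda_{l(\lambda)}>0)$ with transpose $\lambda'$ let $s_\lambda(q)=\det\big(h_{\lambda_i-i+j}(q)\big)_{1\le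 i,j\le l(\lambda)}$, let $d(\lambda)$ be the length of the diagonal of its Young diagram, and let $\alpha_i=\lambda_i-i$, $\beta_i=\lambda'_i-i$ $(1\le i\le d(\lambda))$ be its Frobenius coordinates. Let $s_\lambda(q/\hbar^{1/2})$ denote the polynomial obtained by replacing every $q_k$ by $q_k/\hbar^{1/2}$. Then for every partition $\lambda$ (including the empty one) the polynomial $s_\lambda(q/\hbar^{1/2})$ is a common eigenvector (in particular nonzero) of all the operators $\hat H_k$, $k\ge-1$: $$\hat H_k\,s_\lambda\Big(\frac{q}{\hbar^{1/2}}\Big)=E_k(\lambda,u_0,\hbar)\,s_\lambda\Big(\frac{q}{\hbar^{1/2}}\Big),$$ with the eigenvalue given by either of the two equal expressions $$E_k=c_k(u_0,\hbar)+\hbar^{1/2}\sum_{i=1}^{l(\lambda)}\frac{\big[u_0+\hbar^{1/2}(\lambda_i-i+\frac12)\big]^{k+1}-\big[u_0+\hbar^{1/2}(-i+\frac12)\big]^{k+1}}{(k+1)!}$$ $$\phantom{E_k}=c_k(u_0,\hbar)+\hbar^{1/2}\sum_{i=1}^{d(\lambda)}\frac{\big[u_0+\hbar^{1/2}(\alpha_i+\frac12)\big]^{k+1}-\big[u_0-\hbar^{1/2}(\beta_i+\frac12)\big]^{k+1}}{(k+1)!},$$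 where $$c_k(u_0,\hbar)=-\frac1{(k+2)!}\sum_{j=0}^{k+2}\binom{k+2}{j}\,(1-2^{1-j})\,B_j\,\hbar^{j/2}\,u_0^{\,k+2-j},$$ $B_j$ are the Bernoulli numbers, and zeroth powers are equal to $1$. -/

import Mathlib

namespace QuantumHopf

noncomputable section

/-! ### The Fock space and the Fourier modes of the quantum field -/

/-- The Fock space `ℂ[q₁, q₂, …]`; the variable `q_k`, `k ≥ 1`, is `MvPolynomial.X k`. -/
abbrev Fock : Type := MvPolynomial ℕ+ ℂ

/-- The operator of multiplication by `q_k`. -/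
def qHat (k : ℕ+) : Module.End ℂ Fock :=
  LinearMap.mulLeft ℂ (MvPolynomial.X k)

/-- The operator `ħ k ∂/∂q_k`. -/
def pHat (ħ : ℂ) (k : ℕ+) : Module.End ℂ Fock :=
  (ħ * (k : ℂ)) • (MvPolynomial.pderiv k).toLinearMap

/-- The operator that replaces the Fourier coefficient `u_k`, `k ∈ ℤ`, of
`u(x) = u₀ + ∑_{k ≥ 1} (q_k e^{ikx} + p_k e^{-ikx})`: it is `q̂_k` for `k > 0`, the scalar `u₀`
for `k = 0`, and `p̂_{-k}` for `k < 0`. -/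
def uHat (u₀ ħ : ℂ) : ℤ → Module.End ℂ Fock
  | Int.ofNat 0 => u₀ • 1
  | Int.ofNat (n + 1) => qHat n.succPNat
  | Int.negSucc n => pHat ħ n.succPNat

/-! ### Normal ordering -/

/-- Normal ordering. A classical symbol is a polynomial in the commuting Fourier coefficients `u_k`,
`k ∈ ℤ` (the variable `MvPolynomial.X k`). In each monomial the factors are written in the order
of decreasing `k`, so that all `p`'s are on the right of all `q`'s, and are then replaced by
operators. (The `q̂`'s commute among themselves and so do the `p̂`'s, hence only the relative
position of the `p`'s and the `q`'s matters.) -/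
def normalOrder (u₀ ħ : ℂ) : MvPolynomial ℤ ℂ →ₗ[ℂ] Module.End ℂ Fock :=
  (MvPolynomial.basisMonomials ℤ ℂ).constr ℂ fun m =>
    (((Finsupp.toMultiset m).sort (fun a b => a ≥ b)).map (uHat u₀ ħ)).prod

/-! ### The series `s` and the mean over the circle -/

/-- The power series of `s(t) = sinh (t/2) / (t/2) = (e^{t/2} - e^{-t/2}) / t`. -/
def sSeries : PowerSeries ℂ :=
  PowerSeries.mk fun n => PowerSeries.coeff (n + 1)
    (PowerSeries.rescale (1 / 2 : ℂ) (PowerSeries.exp ℂ) -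
      PowerSeries.rescale (-1 / 2 : ℂ) (PowerSeries.exp ℂ))

theorem X_mul_sSeries : PowerSeries.X * sSeries =
    PowerSeries.rescale (1 / 2 : ℂ) (PowerSeries.exp ℂ) -
      PowerSeries.rescale (-1 / 2 : ℂ) (PowerSeries.exp ℂ) := by
  ext n
  cases n with
  | zero =>
    rw [PowerSeries.coeff_zero_X_mul, map_sub, PowerSeries.coeff_rescale,
      PowerSeries.coeff_rescale]
    simp
  | succ n => rw [PowerSeries.coeff_succ_X_mul, sSeries, PowerSeries.coeff_mk]

theorem constantCoeff_sSeries : PowerSeries.constantCoeff sSeries = 1 := by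
  rw [← PowerSeries.coeff_zero_eq_constantCoeff_apply, sSeries, PowerSeries.coeff_mk]
  simp [PowerSeries.coeff_rescale, PowerSeries.coeff_exp]
  norm_num

/-- `(1/2π) ∫₀^{2π} e^{imx} dx`. -/
def circleMean (m : ℤ) : ℂ :=
  (1 / (2 * (Real.pi : ℂ))) *
    ∫ x in (0 : ℝ)..(2 * Real.pi), Complex.exp (Complex.I * (m : ℂ) * (x : ℂ))

theorem circleMean_eq (m : ℤ) : circleMean m = if m = 0 then 1 else 0 := by
  have hpi : (Real.pi : ℂ) ≠ 0 := by exact_mod_cast Real.pi_ne_zero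
  split_ifs with h
  · subst h
    simp [circleMean]
    field_simp
  · have hm : Complex.I * (m : ℂ) ≠ 0 := mul_ne_zero Complex.I_ne_zero (by exact_mod_cast h)
    rw [circleMean, integral_exp_mul_complex hm]
    have : Complex.I * (m : ℂ) * ((2 * Real.pi : ℝ) : ℂ) = m * (2 * Real.pi * Complex.I) := by
      push_cast; ring
    rw [this, Complex.exp_int_mul_two_pi_mul_I]
    simp

/-! ### Locally finite sums of operators -/

/-- The sum `∑_i T_i` of a family of operators such that, for every `f`, only finitely many of the
`T_i f` are nonzero. -/
def locFinSum {ι : Type} (T : ι → Module.End ℂ Fock)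
    (hT : ∀ f, (Function.support fun i => T i f).Finite) : Module.End ℂ Fock where
  toFun f := ∑ᶠ i, T i f
  map_add' f g := by
    simp only [map_add]
    exact finsum_add_distrib (hT f) (hT g)
  map_smul' c f := by
    simp only [map_smul, RingHom.id_apply]
    exact (smul_finsum' c (hT f)).symm

/-! ### The terms of the generating function -/

/-- The power series in `z` by which the operator `z s(i ħ^{1/2} z ∂_x)` multiplies the Fourier
harmonic `e^{ikx}` (on which `∂_x` is `ik`); `r` stands for `ħ^{1/2}`. -/
def modeFactor (r : ℂ) (k : ℤ) : PowerSeries ℂ :=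
  PowerSeries.X * PowerSeries.rescale (Complex.I * r * (Complex.I * (k : ℂ))) sSeries

/-- The coefficient of `z^m` in the term of
`(1/2π) :∫ (z s(i ħ^{1/2} z ∂_x) u(x))^n dx:` that contains `u_{k_1} ⋯ u_{k_n}`. -/
def term (u₀ ħ r : ℂ) (m : ℕ) {n : ℕ} (k : Fin n → ℤ) : Module.End ℂ Fock :=
  (PowerSeries.coeff m (∏ i, modeFactor r (k i)) * circleMean (∑ i, k i)) •
    normalOrder u₀ ħ (∏ i, MvPolynomial.X (k i))

/-- A product of more than `m` factors, each divisible by `z`, does not contribute to `z^m`. -/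
theorem term_eq_zero (u₀ ħ r : ℂ) {m n : ℕ} (h : m < n) (k : Fin n → ℤ) :
    term u₀ ħ r m k = 0 := by
  have hd : (PowerSeries.X : PowerSeries ℂ) ^ n ∣ ∏ i, modeFactor r (k i) := by
    have := Finset.prod_dvd_prod_of_dvd (s := Finset.univ)
      (f := fun _ : Fin n => (PowerSeries.X : PowerSeries ℂ)) (g := fun i => modeFactor r (k i))
      (fun i _ => Dvd.intro _ rfl)
    simpa using this
  rw [term, PowerSeries.X_pow_dvd_iff.1 hd m h]
  simp

/-! ### Local finiteness -/

/-- The polynomials of degree at most `d`, where `deg q_k = k`. -/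
def degLE (d : ℤ) : Submodule ℂ Fock :=
  Submodule.span ℂ {g | ∃ m : ℕ+ →₀ ℕ,
    ((Finsupp.weight (fun k : ℕ+ => (k : ℕ)) m : ℕ) : ℤ) ≤ d ∧ g = MvPolynomial.monomial m 1}

theorem degLE_of_neg {d : ℤ} (hd : d < 0) {f : Fock} (hf : f ∈ degLE d) : f = 0 := by
  have : degLE d ≤ ⊥ := by
    refine Submodule.span_le.2 ?_
    rintro g ⟨m, hm, -⟩
    omega
  simpa using this hf

theorem exists_mem_degLE (f : Fock) : ∃ W : ℕ, f ∈ degLE W := by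
  refine ⟨f.support.sup fun m => Finsupp.weight (fun k : ℕ+ => (k : ℕ)) m, ?_⟩
  rw [f.as_sum]
  refine Submodule.sum_mem _ fun m hm => ?_
  rw [show MvPolynomial.monomial m (f.coeff m)
    = (f.coeff m) • MvPolynomial.monomial m (1 : ℂ) by simp [MvPolynomial.smul_monomial]]
  refine Submodule.smul_mem _ _ (Submodule.subset_span ⟨m, ?_, rfl⟩)
  rw [← f.as_sum]
  exact_mod_cast Finset.le_sup (f := fun m => Finsupp.weight (fun k : ℕ+ => (k : ℕ)) m) hm

theorem uHat_mem_degLE (u₀ ħ : ℂ) (k d : ℤ) {f : Fock} (hf : f ∈ degLE d) :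
    uHat u₀ ħ k f ∈ degLE (d + k) := by
  suffices h : degLE d ≤ (degLE (d + k)).comap (uHat u₀ ħ k) from h hf
  refine Submodule.span_le.2 ?_
  rintro g ⟨m, hm, rfl⟩
  change uHat u₀ ħ k _ ∈ degLE (d + k)
  match k with
  | Int.ofNat 0 =>
    refine Submodule.smul_mem _ _ (Submodule.subset_span ⟨m, ?_, rfl⟩)
    simpa using hm
  | Int.ofNat (n + 1) =>
    refine Submodule.subset_span ⟨Finsupp.single n.succPNat 1 + m, ?_, ?_⟩
    · rw [map_add, Finsupp.weight_single]
      simp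
      omega
    · simp [uHat, qHat, MvPolynomial.X, MvPolynomial.monomial_mul]
  | Int.negSucc n =>
    change (ħ * (n.succPNat : ℂ)) • MvPolynomial.pderiv n.succPNat _ ∈ _
    refine Submodule.smul_mem _ _ ?_
    rw [MvPolynomial.pderiv_monomial]
    by_cases h0 : m n.succPNat = 0
    · simp [h0]
    · rw [show ∀ (a : ℕ+ →₀ ℕ) (c : ℂ), MvPolynomial.monomial a c
        = c • MvPolynomial.monomial a (1 : ℂ) by simp [MvPolynomial.smul_monomial]]
      refine Submodule.smul_mem _ _ (Submodule.subset_span ⟨_, ?_, rfl⟩)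
      have hs : m - Finsupp.single n.succPNat 1 + Finsupp.single n.succPNat 1 = m :=
        tsub_add_cancel_of_le (by simpa using Nat.one_le_iff_ne_zero.2 h0)
      have hw := congrArg (Finsupp.weight (fun k : ℕ+ => (k : ℕ))) hs
      rw [map_add, Finsupp.weight_single] at hw
      simp at hw
      rw [Int.negSucc_eq]
      omega

theorem list_prod_mem_degLE (u₀ ħ : ℂ) (d : ℤ) {f : Fock} (hf : f ∈ degLE d) (L : List ℤ) :
    (L.map (uHat u₀ ħ)).prod f ∈ degLE (d + L.sum) := by
  induction L with
  | nil => simpa using hf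
  | cons a t ih =>
    have := uHat_mem_degLE u₀ ħ a _ ih
    simp only [List.map_cons, List.prod_cons, List.sum_cons, Module.End.mul_apply]
    rwa [show d + (a + t.sum) = d + t.sum + a by ring]

theorem neg_part_bound (u₀ ħ : ℂ) (d : ℤ) (hd : 0 ≤ d) {f : Fock} (hf : f ∈ degLE d) (L : List ℤ)
    (hL : L.Pairwise fun a b => a ≥ b) (h : (L.map (uHat u₀ ħ)).prod f ≠ 0) :
    0 ≤ d + (L.map fun x => min x 0).sum := by
  induction L with
  | nil => simpa using hd
  | cons a t ih =>
    rw [List.pairwise_cons] at hL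
    have ht : (t.map (uHat u₀ ħ)).prod f ≠ 0 := by
      intro h0
      apply h
      simp [h0]
    rcases le_or_gt 0 a with ha | ha
    · simpa [min_eq_right ha] using ih hL.2 ht
    · have hmap : (a :: t).map (fun x => min x 0) = a :: t := by
        refine (List.map_congr_left (g := id) fun x hx => ?_).trans (List.map_id _)
        rcases List.mem_cons.1 hx with rfl | hx
        · exact min_eq_left ha.le
        · exact min_eq_left ((hL.1 x hx).le.trans ha.le)
      rw [hmap]
      by_contra hneg
      exact h (degLE_of_neg (not_le.1 hneg) (list_prod_mem_degLE u₀ ħ d hf (a :: t)))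

theorem normalOrder_prod_X (u₀ ħ : ℂ) {n : ℕ} (k : Fin n → ℤ) :
    normalOrder u₀ ħ (∏ i, MvPolynomial.X (k i)) =
      (((Finset.univ.val.map k).sort fun a b => a ≥ b).map (uHat u₀ ħ)).prod := by
  have h1 : (∏ i, MvPolynomial.X (k i) : MvPolynomial ℤ ℂ) =
      MvPolynomial.basisMonomials ℤ ℂ (∑ i, Finsupp.single (k i) 1) := by
    rw [MvPolynomial.coe_basisMonomials]
    exact (MvPolynomial.monomial_sum_one _ _).symm
  have h2 : Finsupp.toMultiset (∑ i, Finsupp.single (k i) 1) = Finset.univ.val.map k := by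
    rw [map_sum]
    simp only [Finsupp.toMultiset_single, one_smul]
    rw [Finset.sum, ← Multiset.sum_map_singleton (Finset.univ.val.map k), Multiset.map_map]
    rfl
  rw [h1, normalOrder, Module.Basis.constr_basis, h2]

theorem term_finite (u₀ ħ r : ℂ) (m n : ℕ) (f : Fock) :
    (Function.support fun k : Fin n → ℤ => term u₀ ħ r m k f).Finite := by
  obtain ⟨W, hW⟩ := exists_mem_degLE f
  refine (Set.Finite.pi' (fun _ : Fin n => Set.finite_Icc (-(W : ℤ)) W)).subset ?_
  intro k hk j
  have hk' : term u₀ ħ r m k f ≠ 0 := hk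
  rw [term, circleMean_eq] at hk'
  have hsum : ∑ i, k i = 0 := by
    by_contra h
    simp [h] at hk'
  have hno : normalOrder u₀ ħ (∏ i, MvPolynomial.X (k i)) f ≠ 0 := by
    intro h
    rw [LinearMap.smul_apply, h, smul_zero] at hk'
    exact hk' rfl
  rw [normalOrder_prod_X] at hno
  have hb := neg_part_bound u₀ ħ W (by positivity) hW _ (Multiset.pairwise_sort _ _) hno
  have hb' : 0 ≤ (W : ℤ) + ∑ i, min (k i) 0 := by
    rw [← Multiset.sum_coe, ← Multiset.map_coe, Multiset.sort_eq, Multiset.map_map] at hb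
    exact hb
  have h1 : -∑ i, min (k i) 0 ≥ -min (k j) 0 := by
    rw [← Finset.sum_neg_distrib]
    exact Finset.single_le_sum (f := fun i => -min (k i) 0) (fun i _ => by simp)
      (Finset.mem_univ j)
  have h2 : max (k j) 0 ≤ ∑ i, max (k i) 0 :=
    Finset.single_le_sum (f := fun i => max (k i) 0) (fun i _ => by simp) (Finset.mem_univ j)
  have h3 : ∑ i, min (k i) 0 + ∑ i, max (k i) 0 = 0 := by
    rw [← Finset.sum_add_distrib]
    refine (Finset.sum_congr rfl fun i _ => ?_).trans hsum
    rw [min_add_max, add_zero]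
  rw [Set.mem_Icc]
  omega

/-! ### The quantum Hamiltonians -/

/-- The operator-valued power series in `z`
`(1/2π) :∫₀^{2π} exp (z s(i ħ^{1/2} z ∂_x) u(x)) dx:`. The exponential is expanded as
`∑_n (1/n!) (⋯)^n` and each power over the `n`-tuples of Fourier modes; by `term_eq_zero` the
coefficient of `z^m` only involves `n ≤ m`. -/
def expIntegral (u₀ ħ r : ℂ) : PowerSeries (Module.End ℂ Fock) :=
  PowerSeries.mk fun m => ∑ n ∈ Finset.range (m + 1),
    (1 / (Nat.factorial n : ℂ)) •
      locFinSum (fun k : Fin n → ℤ => term u₀ ħ r m k) (term_finite u₀ ħ r m n)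

/-- The generating function of the quantum Hamiltonians,
`Ĥ(z) = (1 / (2π s(ħ^{1/2} z))) :∫₀^{2π} exp (z s(i ħ^{1/2} z ∂_x) u(x)) dx:`. -/
def generatingH (u₀ ħ r : ℂ) : PowerSeries (Module.End ℂ Fock) :=
  PowerSeries.map (algebraMap ℂ (Module.End ℂ Fock)) (PowerSeries.rescale r sSeries)⁻¹ *
    expIntegral u₀ ħ r

/-- The quantum Hamiltonian `Ĥ_k`, `k ≥ -1`: `Ĥ(z) = 1 + ∑_{k ≥ -1} Ĥ_k z^{k+2}`. -/
def hamiltonian (u₀ ħ r : ℂ) (k : ℤ) : Module.End ℂ Fock :=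
  PowerSeries.coeff (k + 2).toNat (generatingH u₀ ħ r)

/-! ### Schur polynomials -/

/-- The series `∑_{k ≥ 1} q_k z^k / k`. -/
def powerSumSeries : PowerSeries Fock :=
  PowerSeries.mk fun k => if hk : 0 < k then
    MvPolynomial.C (1 / (k : ℂ)) * MvPolynomial.X (⟨k, hk⟩ : ℕ+) else 0

theorem hasSubst_powerSumSeries : PowerSeries.HasSubst powerSumSeries :=
  PowerSeries.HasSubst.of_constantCoeff_zero' (by
    rw [← PowerSeries.coeff_zero_eq_constantCoeff_apply, powerSumSeries, PowerSeries.coeff_mk]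
    simp)

/-- `h_k(q)`, with `∑_{k ≥ 0} h_k(q) z^k = exp (∑_{k ≥ 1} q_k z^k / k)` and `h_k = 0` for `k < 0`. -/
def hPoly (k : ℤ) : Fock :=
  if 0 ≤ k then
    PowerSeries.coeff k.toNat ((PowerSeries.exp ℂ).subst powerSumSeries : PowerSeries Fock)
  else 0

/-- The number `l(λ)` of rows of `λ`. -/
def numRows (lam : YoungDiagram) : ℕ := lam.colLen 0

/-- `s_λ(q) = det (h_{λ_i - i + j}(q))_{1 ≤ i, j ≤ l(λ)}`. -/
def schur (lam : YoungDiagram) : Fock :=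
  Matrix.det (Matrix.of fun i j : Fin (numRows lam) =>
    hPoly ((lam.rowLen i : ℤ) - ((i : ℕ) : ℤ) + ((j : ℕ) : ℤ)))

/-- `s_λ(q / r)`: each `q_k` is replaced by `q_k / r`. -/
def schurScaled (r : ℂ) (lam : YoungDiagram) : Fock :=
  MvPolynomial.aeval (fun k : ℕ+ => MvPolynomial.C r⁻¹ * (MvPolynomial.X k : Fock)) (schur lam)

/-! ### Frobenius coordinates

Rows and columns of a `YoungDiagram` are numbered from `0`. -/

/-- The length `d(λ)` of the diagonal of `λ`. -/
def diagLength (lam : YoungDiagram) : ℕ := (lam.cells.filter fun c => c.1 = c.2).card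

/-- `α_{i+1} = λ_{i+1} - (i+1)`. -/
def frobAlpha (lam : YoungDiagram) (i : ℕ) : ℤ := (lam.rowLen i : ℤ) - ((i : ℤ) + 1)

/-- `β_{i+1} = λ'_{i+1} - (i+1)`, where `λ'` is the transpose of `λ`. -/
def frobBeta (lam : YoungDiagram) (i : ℕ) : ℤ := (lam.transpose.rowLen i : ℤ) - ((i : ℤ) + 1)

/-! ### The eigenvalues -/

/-- `c_k = -(1/(k+2)!) ∑_{j=0}^{k+2} binom(k+2, j) (1 - 2^{1-j}) B_j ħ^{j/2} u₀^{k+2-j}`,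
where `r` stands for `ħ^{1/2}`. -/
def vacuumEigenvalue (u₀ r : ℂ) (k : ℤ) : ℂ :=
  -(1 / (Nat.factorial (k + 2).toNat : ℂ)) *
    ∑ j ∈ Finset.range ((k + 2).toNat + 1),
      (Nat.choose (k + 2).toNat j : ℂ) * (1 - (2 : ℂ) ^ (1 - (j : ℤ))) * ((bernoulli j : ℚ) : ℂ) *
        r ^ j * u₀ ^ ((k + 2).toNat - j)

/-- The eigenvalue `E_k(λ)` as a sum over the rows of `λ`. -/
def eigenvalueRows (u₀ r : ℂ) (lam : YoungDiagram) (k : ℤ) : ℂ :=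
  vacuumEigenvalue u₀ r k + r * ∑ i ∈ Finset.range (numRows lam),
    ((u₀ + r * ((lam.rowLen i : ℂ) - ((i : ℂ) + 1) + 1 / 2)) ^ (k + 1).toNat -
      (u₀ + r * (-((i : ℂ) + 1) + 1 / 2)) ^ (k + 1).toNat) / (Nat.factorial (k + 1).toNat : ℂ)

/-- The eigenvalue `E_k(λ)` as a sum over the Frobenius coordinates of `λ`. -/
def eigenvalueFrobenius (u₀ r : ℂ) (lam : YoungDiagram) (k : ℤ) : ℂ :=
  vacuumEigenvalue u₀ r k + r * ∑ i ∈ Finset.range (diagLength lam),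
    ((u₀ + r * ((frobAlpha lam i : ℂ) + 1 / 2)) ^ (k + 1).toNat -
      (u₀ - r * ((frobBeta lam i : ℂ) + 1 / 2)) ^ (k + 1).toNat) / (Nat.factorial (k + 1).toNat : ℂ)

end

end QuantumHopf

/-!
The proof is bosonic. Let `r = ħ^{1/2}`, `a = e^{rz/2}`, `b = e^{-rz/2}`, and let
`H(t) = ∑ h_n(q/r) t^n`. The `k`-th Fourier mode enters the exponent with the factor
`φ_k = (a^k - b^k) / (r k)` (and `φ_0 = z`), so the normally ordered exponential is `e^{z u₀}` times
multiplication by `g(y) = exp (∑_{k ≥ 1} φ_k q_k y^k) = H(a y) / H(b y)`, composed with the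
substitution `q_k ↦ q_k + r (a^k - b^k) y^{-k}`; integration over the circle takes the constant term
in `y`. This is `coeff_expIntegral_eq_vertexOp`. It rests on two facts: a normally ordered operator
is determined by its commutators with the `q̂_j` and its value at `1`
(`pow_dvd_normalOrderExp_sub`), and `exp (∑ φ_k q_k y^k)` and `H(a y) / H(b y)` have the same
logarithmic derivative (`pow_dvd_coeff_truncExp_sub`). All exponentials in `z` are truncated, and
identities between them hold modulo a power of `z`. In place of Laurent polynomials in `y` there are
polynomials in `y` and an independent variable `v` for `1/y`, with the functional
`y^i v^j ↦ δ_{ij}` as the constant term.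

The resulting vertex operator `T` is diagonalized by means of the Bernstein operators
`B_n f = ∑_k h_{n+k} L_k f`, where `∑_k L_k f v^k = f(q_k - r v^k)`. They build up the Jacobi–Trudi
determinants row by row (`IsComplete.bernstein_jacobiTrudi`), because the substitution takes `h_n` to
`h_n - v h_{n-1}`, which is a column operation. They satisfy
`T B_n = b² B_n T + (1 - b²) a^{2n} B_n` (`IsComplete.vertexOp_bernstein`): after the two shifts are
commuted, the coefficients on both sides differ by the coefficient of `g(a t) H(t) = H(a² t)`. Since
`T 1 = 1`, induction on the number of rows gives
`T s_λ = (b^{2l} + (1 - b²) ∑_{i=1}^l a^{2λ_i} b^{2(i-1)}) s_λ`.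

Division by `s(rz)`, where `r z s(rz) = a - b`, turns this factor into
`1 / s(rz) + r z ∑_i (e^{rz(λ_i - i + 1/2)} - e^{rz(-i + 1/2)})`, and the coefficients of
`e^{z u₀} / s(rz)` are given by Bernoulli numbers because
`t / (e^{t/2} - e^{-t/2}) = 2 B(t/2) - B(t)` for `B(t) = t / (e^t - 1)`. Both forms of the eigenvalue
are sums over the contents of the cells (`sum_rows_eq_sum_frobenius`). Finally `s_λ` is nonzero
because at `q_1 = 1`, `q_k = 0` for `k ≥ 2` the determinant reduces to that of Vandermonde.

The coefficient ring `ℂ⟦z⟧` is replaced by a ring `R` with an isomorphism `ℂ⟦z⟧ ≃+* R`, so that every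
algebraic structure on polynomials over it derives from the commutative ring `R`.
-/

namespace QuantumHopf

/-! ### Power series and logarithmic derivatives -/

open Polynomial in
/-- The `A`-linear functional `∑ c_m v^m ↦ ∑ c_m g_m` on `A[v]`. -/
noncomputable def pairing {A : Type*} [CommRing A] (g : ℕ → A) : A[X] →ₗ[A] A :=
  Polynomial.lsum fun m => LinearMap.mulRight A (g m)

section PowerSeriesLemmas

open PowerSeries

variable {A : Type*} [CommRing A]

@[simp]
theorem pairing_monomial (g : ℕ → A) (m : ℕ) (c : A) :
    pairing g (Polynomial.monomial m c) = c * g m := by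
  simp [pairing, Polynomial.sum_monomial_index]

/-- A power series with zero constant term that solves `u F' = c F`, where `u(0) = 1`, vanishes. -/
theorem eq_zero_of_mul_derivative_eq [IsDomain A] [CharZero A] {F u c : A⟦X⟧}
    (hu : constantCoeff u = 1) (h : u * d⁄dX A F = c * F) (h0 : constantCoeff F = 0) : F = 0 := by
  ext n
  induction n using Nat.strong_induction_on with
  | _ n ih =>
    cases n with
    | zero => simpa using h0
    | succ n =>
      have h1 := congrArg (coeff n) h
      rw [coeff_mul, coeff_mul, Finset.sum_eq_single_of_mem (0, n) (by simp),
        Finset.sum_eq_zero] at h1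
      · rw [coeff_zero_eq_constantCoeff_apply, hu, one_mul, coeff_derivative] at h1
        have : ((n : A) + 1) ≠ 0 := by exact_mod_cast Nat.succ_ne_zero n
        simpa [this] using h1
      · rintro ⟨i, j⟩ hij
        rw [Finset.HasAntidiagonal.mem_antidiagonal] at hij
        simp only at hij
        rw [ih j (by omega)]
        simp
      · rintro ⟨i, j⟩ hij hne
        rw [Finset.HasAntidiagonal.mem_antidiagonal] at hij
        simp only [ne_eq, Prod.mk.injEq, not_and] at hij hne
        rw [coeff_derivative, ih (j + 1) (by omega)]
        simp

/-- The series `x / (1 - x t) = ∑ x^{n+1} t^n`. -/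
noncomputable def geom (x : A) : A⟦X⟧ := mk fun n => x ^ (n + 1)

theorem geom_mul (x : A) : geom x * (1 - C x * X) = C x := by
  ext n
  cases n with
  | zero => simp [geom, mul_sub]
  | succ n =>
    rw [mul_sub, mul_one, ← mul_assoc, map_sub, coeff_succ_mul_X]
    simp [geom, pow_succ]

/-- Two exponentials whose logarithmic derivatives differ by `x / (1 - x t) - y / (1 - y t)` differ
by the factor `(1 - y t) / (1 - x t)`. -/
theorem mul_one_sub_eq_of_logDerivative [IsDomain A] [CharZero A] {H₁ H₀ P : A⟦X⟧} {x y : A}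
    (h₁ : d⁄dX A H₁ = (P + geom x - geom y) * H₁) (h₀ : d⁄dX A H₀ = P * H₀)
    (c₁ : constantCoeff H₁ = 1) (c₀ : constantCoeff H₀ = 1) :
    H₁ * (1 - C x * X) = H₀ * (1 - C y * X) := by
  have hx := geom_mul x
  have hy := geom_mul y
  rw [← sub_eq_zero]
  refine eq_zero_of_mul_derivative_eq (u := 1 - C y * X) (c := P * (1 - C y * X) - C y)
    (by simp) ?_ (by simp [c₁, c₀])
  simp only [map_sub, Derivation.leibniz, derivative_C, derivative_X, derivative_one, smul_eq_mul,
    h₁, h₀]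
  linear_combination H₁ * (1 - C y * X) * hx - H₁ * (1 - C x * X) * hy

/-- The coefficients of `(1 - y t) / (1 - x t)`. -/
def ratioCoeff (x y : A) : ℕ → A
  | 0 => 1
  | n + 1 => x ^ n * (x - y)

theorem mk_ratioCoeff_mul (x y : A) :
    mk (ratioCoeff x y) * (1 - C x * X) = 1 - C y * X := by
  ext n
  rw [mul_sub, mul_one, ← mul_assoc, map_sub]
  match n with
  | 0 => simp [ratioCoeff]
  | 1 => simp [ratioCoeff, coeff_one]
  | n + 2 =>
    simp [ratioCoeff, coeff_succ_mul_X, coeff_one]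
    ring

theorem eq_mul_mk_ratioCoeff {F F₀ : A⟦X⟧} {x y : A}
    (h : F * (1 - C x * X) = F₀ * (1 - C y * X)) : F = F₀ * mk (ratioCoeff x y) := by
  have hu : IsUnit (1 - C x * X : A⟦X⟧) := by
    rw [isUnit_iff_constantCoeff]
    simp
  refine hu.mul_right_cancel ?_
  rw [h, mul_assoc, mk_ratioCoeff_mul]

theorem derivative_rescale (x : A) (F : A⟦X⟧) :
    d⁄dX A (rescale x F) = C x * rescale x (d⁄dX A F) := by
  ext n
  simp [coeff_derivative, coeff_rescale, pow_succ]
  ring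

theorem derivative_map {B : Type*} [CommRing B] (φ : A →+* B) (F : A⟦X⟧) :
    d⁄dX B (map φ F) = map φ (d⁄dX A F) := by
  ext n
  simp [coeff_derivative]

end PowerSeriesLemmas

/-! ### Complete symmetric functions and shifts -/

section Vertex

open PowerSeries

variable {R : Type*} [CommRing R]

/-- The series `∑_{k ≥ 1} ρ q_k t^{k-1}`, the logarithmic derivative of `∑ h_n(ρ q) t^n`. -/
noncomputable def powerSumDeriv (ρ : R) : (MvPolynomial ℕ+ R)⟦X⟧ :=
  mk fun n => MvPolynomial.C ρ * MvPolynomial.X n.succPNat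

/-- `H` is the generating series of the complete symmetric functions in the scaled power sums `ρ q_k`,
characterized by its constant term and its logarithmic derivative. -/
structure IsComplete (ρ : R) (H : (MvPolynomial ℕ+ R)⟦X⟧) : Prop where
  constantCoeff_eq : constantCoeff H = 1
  derivative_eq : d⁄dX _ H = powerSumDeriv ρ * H

/-- The substitution `q_k ↦ q_k + r (α^k - β^k) v^k`. -/
noncomputable def shift (r α β : R) : MvPolynomial ℕ+ R →ₐ[R] Polynomial (MvPolynomial ℕ+ R) :=
  MvPolynomial.aeval fun k : ℕ+ => Polynomial.C (MvPolynomial.X k) +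
    Polynomial.C (MvPolynomial.C (r * (α ^ (k : ℕ) - β ^ (k : ℕ)))) * Polynomial.X ^ (k : ℕ)

theorem shift_C (r α β c : R) :
    shift r α β (MvPolynomial.C c) = Polynomial.C (MvPolynomial.C c) := by
  rw [shift, MvPolynomial.aeval_C]
  rfl

/-- A scalar `α`, times the variable `v`. -/
noncomputable abbrev scaledVar (α : R) : Polynomial (MvPolynomial ℕ+ R) :=
  Polynomial.C (MvPolynomial.C α) * Polynomial.X

theorem map_shift_powerSumDeriv {r ρ : R} (hr : r * ρ = 1) (α β : R) :
    map (shift r α β : MvPolynomial ℕ+ R →+* _) (powerSumDeriv ρ) =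
      map Polynomial.C (powerSumDeriv ρ) + geom (scaledVar α) - geom (scaledVar β) := by
  ext1 n
  have h : (Polynomial.C (MvPolynomial.C ρ) : Polynomial (MvPolynomial ℕ+ R)) *
      Polynomial.C (MvPolynomial.C r) = 1 := by
    rw [← map_mul, ← map_mul, mul_comm, hr, map_one, map_one]
  simp only [powerSumDeriv, geom, scaledVar, coeff_map, coeff_mk, map_add, map_sub, RingHom.coe_coe,
    map_mul, shift_C, mul_pow]
  simp only [shift, MvPolynomial.aeval_X, Nat.succPNat_coe, Nat.succ_eq_add_one, map_mul, map_sub, map_pow]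
  linear_combination ((Polynomial.C (MvPolynomial.C α)) ^ (n + 1) -
    (Polynomial.C (MvPolynomial.C β)) ^ (n + 1)) * Polynomial.X ^ (n + 1) * h

theorem ratioCoeff_scaledVar (α β : R) (n : ℕ) :
    ratioCoeff (scaledVar α) (scaledVar β) n =
      Polynomial.C (MvPolynomial.C (ratioCoeff α β n)) * Polynomial.X ^ n := by
  cases n with
  | zero => simp [ratioCoeff]
  | succ n =>
    simp only [ratioCoeff, scaledVar, map_mul, map_sub, map_pow]
    ring

/-- The series `H(a y) / H(b y)` by which the vertex operator multiplies. -/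
noncomputable def vertexSeries (a b : R) (H : (MvPolynomial ℕ+ R)⟦X⟧) : (MvPolynomial ℕ+ R)⟦X⟧ :=
  rescale (MvPolynomial.C a) H * invOfUnit (rescale (MvPolynomial.C b) H) 1

theorem IsComplete.constantCoeff_rescale {ρ : R} {H : (MvPolynomial ℕ+ R)⟦X⟧}
    (hH : IsComplete ρ H) (x : MvPolynomial ℕ+ R) : constantCoeff (rescale x H) = 1 := by
  rw [← coeff_zero_eq_constantCoeff_apply, coeff_rescale, coeff_zero_eq_constantCoeff_apply,
    hH.constantCoeff_eq]
  simp

theorem IsComplete.vertexSeries_mul {ρ : R} {H : (MvPolynomial ℕ+ R)⟦X⟧} (hH : IsComplete ρ H)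
    (a b : R) :
    vertexSeries a b H * rescale (MvPolynomial.C b) H = rescale (MvPolynomial.C a) H := by
  rw [vertexSeries, mul_assoc, mul_comm (invOfUnit _ _), mul_invOfUnit _ _
    (by simpa using hH.constantCoeff_rescale _), mul_one]

theorem IsComplete.constantCoeff_vertexSeries {ρ : R} {H : (MvPolynomial ℕ+ R)⟦X⟧}
    (hH : IsComplete ρ H) (a b : R) : constantCoeff (vertexSeries a b H) = 1 := by
  have h := congrArg constantCoeff (hH.vertexSeries_mul a b)
  rwa [map_mul, hH.constantCoeff_rescale, hH.constantCoeff_rescale, mul_one] at h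

theorem IsComplete.derivative_rescale {ρ : R} {H : (MvPolynomial ℕ+ R)⟦X⟧}
    (hH : IsComplete ρ H) (x : MvPolynomial ℕ+ R) :
    d⁄dX _ (rescale x H) = C x * rescale x (powerSumDeriv ρ) * rescale x H := by
  rw [QuantumHopf.derivative_rescale, hH.derivative_eq, map_mul, mul_assoc]

theorem IsComplete.derivative_vertexSeries {ρ : R} {H : (MvPolynomial ℕ+ R)⟦X⟧}
    (hH : IsComplete ρ H) (a b : R) :
    d⁄dX _ (vertexSeries a b H) =
      (C (MvPolynomial.C a) * rescale (MvPolynomial.C a) (powerSumDeriv ρ) -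
        C (MvPolynomial.C b) * rescale (MvPolynomial.C b) (powerSumDeriv ρ)) *
          vertexSeries a b H := by
  have h := hH.vertexSeries_mul a b
  have hd := congrArg (d⁄dX _) h
  rw [Derivation.leibniz, hH.derivative_rescale, hH.derivative_rescale, smul_eq_mul,
    smul_eq_mul] at hd
  have hu : IsUnit (rescale (MvPolynomial.C b) H) := by
    rw [isUnit_iff_constantCoeff, hH.constantCoeff_rescale]
    exact isUnit_one
  refine hu.mul_right_cancel ?_
  linear_combination hd - C (MvPolynomial.C a) * rescale (MvPolynomial.C a) (powerSumDeriv ρ) * h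

/-- With `a b = 1` the relation `g(a t) H(t) = H(a² t)` holds for `g = vertexSeries a b H`. -/
theorem IsComplete.sum_vertexSeries {ρ : R} {H : (MvPolynomial ℕ+ R)⟦X⟧} (hH : IsComplete ρ H)
    {a b : R} (hab : a * b = 1) (n : ℕ) :
    ∑ p ∈ Finset.HasAntidiagonal.antidiagonal n,
      MvPolynomial.C (a ^ p.1) * coeff p.1 (vertexSeries a b H) * coeff p.2 H =
        MvPolynomial.C (a ^ (2 * n)) * coeff n H := by
  have h := congrArg (fun F => MvPolynomial.C (a ^ n) * coeff n F) (hH.vertexSeries_mul a b)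
  simp only [coeff_mul, coeff_rescale, Finset.mul_sum] at h
  rw [two_mul, pow_add, map_mul, mul_assoc]
  simp only [map_pow] at h ⊢
  rw [← h]
  refine Finset.sum_congr rfl fun p hp => ?_
  rw [Finset.HasAntidiagonal.mem_antidiagonal] at hp
  have hab' : (MvPolynomial.C a * MvPolynomial.C b : MvPolynomial ℕ+ R) ^ p.2 = 1 := by
    rw [← map_mul, hab, map_one, one_pow]
  rw [mul_pow] at hab'
  rw [← hp, pow_add]
  linear_combination -(MvPolynomial.C a ^ p.1 * coeff p.1 (vertexSeries a b H) * coeff p.2 H) * hab'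

variable [IsDomain R] [CharZero R]

/-- The shift multiplies `H(t)` by `(1 - β v t) / (1 - α v t)`. -/
theorem IsComplete.map_shift {r ρ : R} (hr : r * ρ = 1) {H : (MvPolynomial ℕ+ R)⟦X⟧}
    (hH : IsComplete ρ H) (α β : R) :
    map (shift r α β : MvPolynomial ℕ+ R →+* _) H * (1 - C (scaledVar α) * X) =
      map Polynomial.C H * (1 - C (scaledVar β) * X) := by
  refine mul_one_sub_eq_of_logDerivative (P := map Polynomial.C (powerSumDeriv ρ)) ?_ ?_ ?_ ?_
  · rw [derivative_map, hH.derivative_eq, map_mul, map_shift_powerSumDeriv hr]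
  · rw [derivative_map, hH.derivative_eq, map_mul]
  · rw [← coeff_zero_eq_constantCoeff_apply, coeff_map, coeff_zero_eq_constantCoeff_apply,
      hH.constantCoeff_eq, map_one]
  · rw [← coeff_zero_eq_constantCoeff_apply, coeff_map, coeff_zero_eq_constantCoeff_apply,
      hH.constantCoeff_eq, map_one]

theorem IsComplete.shift_coeff {r ρ : R} (hr : r * ρ = 1) {H : (MvPolynomial ℕ+ R)⟦X⟧}
    (hH : IsComplete ρ H) (α β : R) (n : ℕ) :
    shift r α β (coeff n H) = ∑ p ∈ Finset.HasAntidiagonal.antidiagonal n,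
      Polynomial.C (coeff p.1 H) * ratioCoeff (scaledVar α) (scaledVar β) p.2 := by
  have h := congrArg (coeff n) (eq_mul_mk_ratioCoeff (hH.map_shift hr α β))
  rw [coeff_map, coeff_mul] at h
  simpa using h

/-- The shift `q_k ↦ q_k - r v^k` multiplies `H(a y) / H(b y)` by `(1 - a v y) / (1 - b v y)`. -/
theorem IsComplete.shift_vertexSeries_coeff {r ρ : R} (hr : r * ρ = 1)
    {H : (MvPolynomial ℕ+ R)⟦X⟧} (hH : IsComplete ρ H) (a b : R) (n : ℕ) :
    shift r 0 1 (coeff n (vertexSeries a b H)) = ∑ p ∈ Finset.HasAntidiagonal.antidiagonal n,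
      Polynomial.C (coeff p.1 (vertexSeries a b H)) *
        ratioCoeff (scaledVar b) (scaledVar a) p.2 := by
  set S : MvPolynomial ℕ+ R →+* Polynomial (MvPolynomial ℕ+ R) :=
    (shift r 0 1 : MvPolynomial ℕ+ R →+* Polynomial (MvPolynomial ℕ+ R)) with hS
  have h0 : map S H = map Polynomial.C H * (1 - C Polynomial.X * X) := by
    simpa using hH.map_shift hr 0 1
  have hres : ∀ (x : R) (F : (MvPolynomial ℕ+ R)⟦X⟧),
      map S (rescale (MvPolynomial.C x) F) =
        rescale (Polynomial.C (MvPolynomial.C x)) (map S F) := by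
    intro x F
    ext1 m
    simp [coeff_rescale, hS]
  have hres' : ∀ (x : R) (F : (MvPolynomial ℕ+ R)⟦X⟧),
      map Polynomial.C (rescale (MvPolynomial.C x) F) =
        rescale (Polynomial.C (MvPolynomial.C x)) (map Polynomial.C F) := by
    intro x F
    ext1 m
    simp [coeff_rescale]
  have hlin : ∀ x : R, rescale (Polynomial.C (MvPolynomial.C x))
      (1 - C Polynomial.X * X : (Polynomial (MvPolynomial ℕ+ R))⟦X⟧) =
        1 - C (scaledVar x) * X := by
    intro x
    rw [map_sub, map_one, map_mul, rescale_X, scaledVar, map_mul]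
    have : ∀ y : Polynomial (MvPolynomial ℕ+ R),
        rescale (Polynomial.C (MvPolynomial.C x)) (C y) = C y := by
      intro y
      ext1 m
      cases m <;> simp [coeff_rescale, coeff_C]
    rw [this]
    ring
  have h1 := congrArg (map S) (hH.vertexSeries_mul a b)
  have h2 := congrArg (map Polynomial.C) (hH.vertexSeries_mul a b)
  rw [map_mul, hres, hres, h0, map_mul, map_mul, hlin, hlin] at h1
  rw [map_mul, hres', hres'] at h2
  have hu : IsUnit (rescale (Polynomial.C (MvPolynomial.C b)) (map Polynomial.C H)) := by
    rw [← hres', isUnit_iff_constantCoeff, ← coeff_zero_eq_constantCoeff_apply, coeff_map,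
      coeff_zero_eq_constantCoeff_apply, hH.constantCoeff_rescale, map_one]
    exact isUnit_one
  have h3 : map S (vertexSeries a b H) * (1 - C (scaledVar b) * X) =
      map Polynomial.C (vertexSeries a b H) * (1 - C (scaledVar a) * X) := by
    refine hu.mul_right_cancel ?_
    linear_combination h1 - (1 - C (scaledVar a) * X) * h2
  have h := congrArg (coeff n) (eq_mul_mk_ratioCoeff h3)
  rw [coeff_map, coeff_mul] at h
  simpa [hS] using h

end Vertex

/-! ### Bernstein operators and the vertex operator -/

section Bernstein

open Polynomial

variable {R : Type*} [CommRing R]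

/-- The vertex operator `f ↦ ∑_m g_m D_m f`, where `g = H(a y) / H(b y)` and
`∑_m D_m f v^m = f(q_k + r (a^k - b^k) v^k)`. It is the constant term in `y` of the product of
`H(a y) / H(b y)` and the shift operator at `v = 1/y`. -/
noncomputable def vertexOp (r a b : R) (H : PowerSeries (MvPolynomial ℕ+ R))
    (f : MvPolynomial ℕ+ R) : MvPolynomial ℕ+ R :=
  pairing (fun m => PowerSeries.coeff m (vertexSeries a b H)) (shift r a b f)

/-- The Bernstein operator `f ↦ ∑_k h_{n+k} L_k f`, where `∑_k L_k f v^k = f(q_k - r v^k)`. -/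
noncomputable def bernstein (r : R) (H : PowerSeries (MvPolynomial ℕ+ R)) (n : ℕ)
    (f : MvPolynomial ℕ+ R) : MvPolynomial ℕ+ R :=
  pairing (fun k => PowerSeries.coeff (n + k) H) (shift r 0 1 f)

theorem pairing_mul_sum {A : Type*} [CommRing A] (g : ℕ → A) (s : Finset (ℕ × ℕ)) (x y : ℕ → A)
    (p : A[X]) :
    pairing g (p * ∑ i ∈ s, C (x i.1) * (C (y i.2) * X ^ i.2)) =
      pairing (fun m => ∑ i ∈ s, x i.1 * y i.2 * g (m + i.2)) p := by
  induction p using Polynomial.induction_on' with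
  | add p q hp hq => rw [add_mul, map_add, hp, hq, map_add]
  | monomial m c =>
    rw [Finset.mul_sum, map_sum, pairing_monomial, Finset.mul_sum]
    refine Finset.sum_congr rfl fun i _ => ?_
    rw [C_mul_X_pow_eq_monomial, C_mul_monomial, monomial_mul_monomial, pairing_monomial]
    ring

/-- The functional `∑ c_{k,m} w^m v^k ↦ ∑ c_{k,m} κ_{k,m}` on `A[w][v]`. -/
noncomputable def pairing₂ {A : Type*} [CommRing A] (κ : ℕ → ℕ → A) : A[X][X] →ₗ[A] A :=
  Polynomial.lsum fun k => pairing (κ k)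

@[simp]
theorem pairing₂_monomial {A : Type*} [CommRing A] (κ : ℕ → ℕ → A) (k : ℕ) (p : A[X]) :
    pairing₂ κ (monomial k p) = pairing (κ k) p := by
  simp [pairing₂, Polynomial.sum_monomial_index]

theorem pairing₂_ext {A : Type*} [CommRing A] {φ ψ : A[X][X] →ₗ[A] A}
    (h : ∀ k m c, φ (monomial k (monomial m c)) = ψ (monomial k (monomial m c))) : φ = ψ := by
  ext p
  induction p using Polynomial.induction_on' with
  | add p q hp hq => rw [map_add, hp, hq, map_add]
  | monomial k p =>
    induction p using Polynomial.induction_on' with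
    | add p q hp hq => rw [map_add, map_add, hp, hq, map_add]
    | monomial m c => exact h k m c

theorem pairing₂_swap {A : Type*} [CommRing A] (κ : ℕ → ℕ → A) (p : A[X][X]) :
    pairing₂ κ (Bivariate.swap (R := A) p) = pairing₂ (fun k m => κ m k) p := by
  have : pairing₂ κ ∘ₗ (Bivariate.swap (R := A)).toLinearMap = pairing₂ fun k m => κ m k := by
    refine pairing₂_ext fun k m c => ?_
    simp [Bivariate.swap_monomial_monomial]
  exact congrArg (fun φ => φ p) this

/-- Shifts commute: the two shifts are carried out with respect to independent variables. -/
theorem swap_map_shift (r α β γ δ : R) (f : MvPolynomial ℕ+ R) :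
    Bivariate.swap (R := MvPolynomial ℕ+ R)
      (Polynomial.map (shift r α β : MvPolynomial ℕ+ R →+* _) (shift r γ δ f)) =
    Polynomial.map (shift r γ δ : MvPolynomial ℕ+ R →+* _) (shift r α β f) := by
  induction f using MvPolynomial.induction_on with
  | C c => simp [Bivariate.swap_C_C]
  | add p q hp hq => simp only [map_add, Polynomial.map_add, hp, hq]
  | mul_X p k hp =>
    rw [map_mul, map_mul, Polynomial.map_mul, Polynomial.map_mul, map_mul, hp]
    congr 1
    have hk : ∀ α β : R, shift r α β (MvPolynomial.X k) = Polynomial.C (MvPolynomial.X k) +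
      Polynomial.C (MvPolynomial.C (r * (α ^ (k : ℕ) - β ^ (k : ℕ)))) * Polynomial.X ^ (k : ℕ) :=
      fun α β => by rw [shift, MvPolynomial.aeval_X]
    rw [hk, hk]
    simp only [Polynomial.map_add, Polynomial.map_mul, Polynomial.map_C, Polynomial.map_pow,
      Polynomial.map_X, RingHom.coe_coe, hk, shift_C, map_add, map_mul, map_pow,
      Bivariate.swap_C_C, Bivariate.swap_X, Bivariate.swap_Y]
    ring

/-- The shifts `D` and `L` combine, at the arguments `a v` and `a² v`, to the shift `L` because
`(a^k - b^k) a^k - a^{2k} = -1` for `a b = 1`. -/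
theorem eval₂_map_shift (r : R) {a b : R} (hab : a * b = 1) (f : MvPolynomial ℕ+ R) :
    Polynomial.eval₂ (Polynomial.eval₂RingHom Polynomial.C (scaledVar a)) (scaledVar (a ^ 2))
      (Polynomial.map (shift r a b : MvPolynomial ℕ+ R →+* _) (shift r 0 1 f)) =
    shift r 0 1 f := by
  induction f using MvPolynomial.induction_on with
  | C c => simp
  | add p q hp hq => simp only [map_add, Polynomial.map_add, Polynomial.eval₂_add, hp, hq]
  | mul_X p k hp =>
    rw [map_mul, Polynomial.map_mul, Polynomial.eval₂_mul, hp]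
    congr 1
    have hk : ∀ α β : R, shift r α β (MvPolynomial.X k) = Polynomial.C (MvPolynomial.X k) +
      Polynomial.C (MvPolynomial.C (r * (α ^ (k : ℕ) - β ^ (k : ℕ)))) * Polynomial.X ^ (k : ℕ) :=
      fun α β => by rw [shift, MvPolynomial.aeval_X]
    rw [hk]
    simp only [Polynomial.map_add, Polynomial.map_mul, Polynomial.map_C, Polynomial.map_pow,
      Polynomial.map_X, RingHom.coe_coe, hk, shift_C, Polynomial.eval₂_add, Polynomial.eval₂_mul,
      Polynomial.eval₂_C, Polynomial.eval₂_pow, Polynomial.eval₂_X,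
      Polynomial.coe_eval₂RingHom]
    have h : (Polynomial.C (MvPolynomial.C a) : Polynomial (MvPolynomial ℕ+ R)) ^ (k : ℕ) *
        Polynomial.C (MvPolynomial.C b) ^ (k : ℕ) = 1 := by
      rw [← mul_pow, ← map_mul, ← map_mul, hab, map_one, map_one, one_pow]
    simp only [scaledVar, map_mul, map_sub, map_pow, mul_pow, zero_pow k.ne_zero, one_pow, map_one,
      map_zero]
    linear_combination (-Polynomial.C (MvPolynomial.C r) * Polynomial.X ^ (k : ℕ)) * h

theorem pairing₂_eval₂ (x : ℕ → MvPolynomial ℕ+ R) (a : R) (p : (MvPolynomial ℕ+ R)[X][X]) :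
    pairing₂ (fun k m => MvPolynomial.C (a ^ (2 * k + m)) * x (k + m)) p =
      pairing x (Polynomial.eval₂ (Polynomial.eval₂RingHom Polynomial.C (scaledVar a))
        (scaledVar (a ^ 2)) p) := by
  induction p using Polynomial.induction_on' with
  | add p q hp hq => rw [map_add, Polynomial.eval₂_add, map_add, hp, hq]
  | monomial k p =>
    induction p using Polynomial.induction_on' with
    | add p q hp hq => rw [map_add, map_add, Polynomial.eval₂_add, map_add, hp, hq]
    | monomial m c =>
      rw [pairing₂_monomial, pairing_monomial, Polynomial.eval₂_monomial,
        Polynomial.coe_eval₂RingHom, Polynomial.eval₂_monomial, scaledVar, scaledVar, mul_pow,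
        mul_pow]
      have : C c * (C (MvPolynomial.C a) ^ m * X ^ m) *
          (C (MvPolynomial.C (a ^ 2)) ^ k * X ^ k) =
          monomial (k + m) (c * MvPolynomial.C (a ^ (2 * k + m))) := by
        rw [← C_mul_X_pow_eq_monomial]
        simp only [map_mul, map_pow]
        ring
      rw [this, pairing_monomial, mul_assoc]

/-- The identity of scalars behind the commutation relation: after reindexing, both sums run over
parts of the sum for the coefficient of `g(a t) H(t) = H(a² t)`. -/
theorem IsComplete.sum_ratioCoeff {ρ : R} {H : PowerSeries (MvPolynomial ℕ+ R)}
    (hH : IsComplete ρ H) {a b : R} (hab : a * b = 1) (g h : ℕ → MvPolynomial ℕ+ R)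
    (hg : ∀ n, g n = PowerSeries.coeff n (vertexSeries a b H))
    (hh : ∀ n, h n = PowerSeries.coeff n H) (m N : ℕ) :
    ∑ i ∈ Finset.HasAntidiagonal.antidiagonal N,
        h i.1 * MvPolynomial.C (ratioCoeff a b i.2) * g (m + i.2) =
      MvPolynomial.C (b ^ 2) * (∑ i ∈ Finset.HasAntidiagonal.antidiagonal m,
        g i.1 * MvPolynomial.C (ratioCoeff b a i.2) * h (N + i.2)) +
      MvPolynomial.C ((1 - b ^ 2) * a ^ (2 * N + m)) * h (N + m) := by
  have key := hH.sum_vertexSeries hab (m + N)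
  have hone : ∀ n : ℕ, a ^ n * b ^ n = 1 := fun n => by rw [← mul_pow, hab, one_pow]
  have hA : ∀ j, a ^ m * ratioCoeff a b j = (1 - b ^ 2) * a ^ (m + j) +
      if j = 0 then a ^ m * b ^ 2 else 0 := by
    intro j
    cases j with
    | zero => simp [ratioCoeff]; ring
    | succ j =>
      simp only [ratioCoeff, Nat.succ_ne_zero, if_false]
      linear_combination (a ^ m * a ^ j * b) * hab
  have hB : ∀ j ≤ m, a ^ m * (b ^ 2 * ratioCoeff b a j) = -((1 - b ^ 2) * a ^ (m - j)) +
      if j = 0 then a ^ m else 0 := by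
    intro j hj
    cases j with
    | zero => simp [ratioCoeff]; ring
    | succ j =>
      obtain ⟨l, rfl⟩ := Nat.exists_eq_add_of_le hj
      simp only [ratioCoeff, Nat.succ_ne_zero, if_false, Nat.add_sub_cancel_left]
      have := hone (j + 1)
      linear_combination (a ^ l * (b ^ 2 - a * b)) * this - a ^ l * hab
  simp only [← hg, ← hh] at key
  rw [Finset.Nat.sum_antidiagonal_eq_sum_range_succ_mk, Nat.succ_eq_add_one, add_assoc,
    Finset.sum_range_add] at key
  have h1 : MvPolynomial.C (a ^ m) * ∑ i ∈ Finset.HasAntidiagonal.antidiagonal N,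
        h i.1 * MvPolynomial.C (ratioCoeff a b i.2) * g (m + i.2) =
      MvPolynomial.C (1 - b ^ 2) * ∑ j ∈ Finset.range (N + 1),
        MvPolynomial.C (a ^ (m + j)) * g (m + j) * h (m + N - (m + j)) +
      MvPolynomial.C (a ^ m * b ^ 2) * (g m * h N) := by
    rw [← Finset.Nat.sum_antidiagonal_swap]
    rw [Finset.Nat.sum_antidiagonal_eq_sum_range_succ_mk, Finset.mul_sum]
    have : MvPolynomial.C (a ^ m * b ^ 2) * (g m * h N) = ∑ j ∈ Finset.range (N + 1),
        if j = 0 then MvPolynomial.C (a ^ m * b ^ 2) * (g m * h N) else 0 := by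
      simp
    rw [this, Finset.mul_sum, ← Finset.sum_add_distrib]
    refine Finset.sum_congr rfl fun j hj => ?_
    have hj' := congrArg (MvPolynomial.C (σ := ℕ+)) (hA j)
    rw [Nat.add_sub_add_left]
    simp only [Prod.swap_prod_mk]
    split_ifs at hj' ⊢ with h0
    · subst h0
      simp only [map_add, map_mul, add_zero, Nat.sub_zero] at hj' ⊢
      linear_combination (h N * g m) * hj'
    · simp only [map_mul, add_zero] at hj' ⊢
      linear_combination (h (N - j) * g (m + j)) * hj'
  have h2 : MvPolynomial.C (a ^ m) * (MvPolynomial.C (b ^ 2) *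
        ∑ i ∈ Finset.HasAntidiagonal.antidiagonal m,
          g i.1 * MvPolynomial.C (ratioCoeff b a i.2) * h (N + i.2)) =
      -MvPolynomial.C (1 - b ^ 2) * ((∑ j ∈ Finset.range m,
        MvPolynomial.C (a ^ j) * g j * h (m + N - j)) + MvPolynomial.C (a ^ m) * (g m * h N)) +
      MvPolynomial.C (a ^ m) * (g m * h N) := by
    have hlast : (∑ j ∈ Finset.range m, MvPolynomial.C (a ^ j) * g j * h (m + N - j)) +
        MvPolynomial.C (a ^ m) * (g m * h N) =
        ∑ j ∈ Finset.range (m + 1), MvPolynomial.C (a ^ j) * g j * h (m + N - j) := by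
      rw [Finset.sum_range_succ, Nat.add_sub_cancel_left, mul_assoc]
    rw [hlast, ← Finset.Nat.sum_antidiagonal_eq_sum_range_succ_mk
      (fun i : ℕ × ℕ => MvPolynomial.C (a ^ i.1) * g i.1 * h (m + N - i.1)) m]
    have : MvPolynomial.C (a ^ m) * (g m * h N) =
        ∑ i ∈ Finset.HasAntidiagonal.antidiagonal m,
          if i.2 = 0 then MvPolynomial.C (a ^ m) * (g m * h N) else 0 := by
      rw [← Finset.Nat.sum_antidiagonal_swap, Finset.Nat.sum_antidiagonal_eq_sum_range_succ_mk]
      simp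
    rw [this, Finset.mul_sum, Finset.mul_sum, Finset.mul_sum, ← Finset.sum_add_distrib]
    refine Finset.sum_congr rfl fun i hi => ?_
    obtain ⟨i, j⟩ := i
    rw [Finset.HasAntidiagonal.mem_antidiagonal] at hi
    simp only at hi ⊢
    have hj' := congrArg (MvPolynomial.C (σ := ℕ+)) (hB j (by omega))
    rw [show m - j = i by omega] at hj'
    rw [show m + N - i = N + j by omega]
    split_ifs at hj' ⊢ with h0
    · subst h0
      obtain rfl : i = m := by omega
      simp only [map_add, map_mul, map_neg, add_zero] at hj' ⊢
      linear_combination (h N * g i) * hj'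
    · simp only [map_mul, map_neg, add_zero] at hj' ⊢
      linear_combination (h (N + j) * g i) * hj'
  have hu : IsUnit (MvPolynomial.C (a ^ m) : MvPolynomial ℕ+ R) :=
    (IsUnit.of_mul_eq_one (b ^ m) (hone m)).map _
  refine hu.mul_left_cancel ?_
  rw [mul_add, h1, h2, Nat.add_comm N m]
  have h3 : MvPolynomial.C (a ^ m) * (MvPolynomial.C ((1 - b ^ 2) * a ^ (2 * N + m)) * h (m + N)) =
      MvPolynomial.C (1 - b ^ 2) * (MvPolynomial.C (a ^ (2 * (m + N))) * h (m + N)) := by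
    rw [← mul_assoc, ← mul_assoc, ← map_mul, ← map_mul]
    congr 2
    ring
  rw [h3, ← key]
  simp only [map_mul, map_sub, map_one]
  ring

variable [IsDomain R] [CharZero R]

/-- The vertex operator and the Bernstein operators commute up to the factor `b²` and a multiple of
the Bernstein operator: the difference of the two products is concentrated where the arguments of
the vertex operators meet. -/
theorem IsComplete.vertexOp_bernstein {r ρ : R} (hr : r * ρ = 1)
    {H : PowerSeries (MvPolynomial ℕ+ R)} (hH : IsComplete ρ H) {a b : R} (hab : a * b = 1) (n : ℕ)
    (f : MvPolynomial ℕ+ R) :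
    vertexOp r a b H (bernstein r H n f) =
      MvPolynomial.C (b ^ 2) * bernstein r H n (vertexOp r a b H f) +
      MvPolynomial.C ((1 - b ^ 2) * a ^ (2 * n)) * bernstein r H n f := by
  set g : ℕ → MvPolynomial ℕ+ R := fun n => PowerSeries.coeff n (vertexSeries a b H) with hg
  set h : ℕ → MvPolynomial ℕ+ R := fun n => PowerSeries.coeff n H with hh
  have h1 : ∀ p : (MvPolynomial ℕ+ R)[X],
      vertexOp r a b H (pairing (fun k => h (n + k)) p) =
        pairing₂ (fun k m => ∑ i ∈ Finset.HasAntidiagonal.antidiagonal (n + k),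
          h i.1 * MvPolynomial.C (ratioCoeff a b i.2) * g (m + i.2))
          (Polynomial.map (shift r a b : MvPolynomial ℕ+ R →+* _) p) := by
    intro p
    induction p using Polynomial.induction_on' with
    | add p q hp hq =>
      rw [map_add, Polynomial.map_add, map_add, ← hp, ← hq, vertexOp, map_add, map_add]
      rfl
    | monomial k c =>
      rw [pairing_monomial, Polynomial.map_monomial, pairing₂_monomial, vertexOp, map_mul,
        hH.shift_coeff hr]
      simp only [ratioCoeff_scaledVar]
      exact pairing_mul_sum g _ h (fun j => MvPolynomial.C (ratioCoeff a b j)) _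
  have h2 : ∀ p : (MvPolynomial ℕ+ R)[X],
      bernstein r H n (pairing g p) =
        pairing₂ (fun m k => ∑ i ∈ Finset.HasAntidiagonal.antidiagonal m,
          g i.1 * MvPolynomial.C (ratioCoeff b a i.2) * h (n + k + i.2))
          (Polynomial.map (shift r 0 1 : MvPolynomial ℕ+ R →+* _) p) := by
    intro p
    induction p using Polynomial.induction_on' with
    | add p q hp hq =>
      rw [map_add, Polynomial.map_add, map_add, ← hp, ← hq, bernstein, map_add, map_add]
      rfl
    | monomial m c =>
      rw [pairing_monomial, Polynomial.map_monomial, pairing₂_monomial, bernstein, map_mul,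
        hg, hH.shift_vertexSeries_coeff hr]
      simp only [ratioCoeff_scaledVar]
      simp only [add_assoc]
      exact pairing_mul_sum (fun k => h (n + k)) _ g
        (fun j => MvPolynomial.C (ratioCoeff b a j)) _
  have h3 : ∀ p : (MvPolynomial ℕ+ R)[X][X],
      pairing₂ (fun k m => ∑ i ∈ Finset.HasAntidiagonal.antidiagonal (n + k),
          h i.1 * MvPolynomial.C (ratioCoeff a b i.2) * g (m + i.2)) p =
        MvPolynomial.C (b ^ 2) * pairing₂ (fun k m => ∑ i ∈ Finset.HasAntidiagonal.antidiagonal m,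
          g i.1 * MvPolynomial.C (ratioCoeff b a i.2) * h (n + k + i.2)) p +
        MvPolynomial.C ((1 - b ^ 2) * a ^ (2 * n)) *
          pairing₂ (fun k m => MvPolynomial.C (a ^ (2 * k + m)) * h (n + (k + m))) p := by
    intro p
    rw [← smul_eq_mul, ← smul_eq_mul, ← LinearMap.smul_apply, ← LinearMap.smul_apply,
      ← LinearMap.add_apply]
    congr 1
    refine pairing₂_ext fun k m c => ?_
    simp only [LinearMap.add_apply, LinearMap.smul_apply, pairing₂_monomial, pairing_monomial]
    rw [hH.sum_ratioCoeff hab g h (fun _ => rfl) (fun _ => rfl) m (n + k)]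
    simp only [smul_eq_mul, mul_add, pow_add, map_mul, add_assoc]
    ring
  rw [bernstein, h1, h3, vertexOp, h2, ← swap_map_shift, pairing₂_swap, swap_map_shift,
    pairing₂_eval₂ (fun k => h (n + k)), eval₂_map_shift r hab]

end Bernstein

/-! ### Jacobi–Trudi determinants -/

section JacobiTrudi

variable {R : Type*} [CommRing R]

/-- The coefficients of `H`, extended by zero to negative indices. -/
noncomputable def intCoeff (H : PowerSeries (MvPolynomial ℕ+ R)) (n : ℤ) : MvPolynomial ℕ+ R :=
  if 0 ≤ n then PowerSeries.coeff n.toNat H else 0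

theorem intCoeff_natCast (H : PowerSeries (MvPolynomial ℕ+ R)) (n : ℕ) :
    intCoeff H n = PowerSeries.coeff n H := by
  simp [intCoeff]

theorem intCoeff_of_neg (H : PowerSeries (MvPolynomial ℕ+ R)) {n : ℤ} (hn : n < 0) :
    intCoeff H n = 0 := by
  simp [intCoeff, not_le.2 hn]

/-- The Jacobi–Trudi determinant `det (h_{μ_i - i + j})`; the row lengths `μ_i` need not
decrease. -/
noncomputable def jacobiTrudi (H : PowerSeries (MvPolynomial ℕ+ R)) {l : ℕ} (μ : Fin l → ℕ) :
    MvPolynomial ℕ+ R :=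
  Matrix.det (Matrix.of fun i j : Fin l => intCoeff H ((μ i : ℤ) - ((i : ℕ) : ℤ) + ((j : ℕ) : ℤ)))

/-- The factor by which `vertexOp r a b H` multiplies `jacobiTrudi H μ`. -/
def vertexEigenvalue (a b : R) {l : ℕ} (μ : Fin l → ℕ) : R :=
  b ^ (2 * l) + (1 - b ^ 2) * ∑ i, a ^ (2 * μ i) * b ^ (2 * (i : ℕ))

variable [IsDomain R] [CharZero R]

theorem IsComplete.shift_intCoeff {r ρ : R} (hr : r * ρ = 1) {H : PowerSeries (MvPolynomial ℕ+ R)}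
    (hH : IsComplete ρ H) (n : ℤ) :
    shift r 0 1 (intCoeff H n) =
      Polynomial.C (intCoeff H n) - Polynomial.X * Polynomial.C (intCoeff H (n - 1)) := by
  have h := hH.map_shift hr 0 1
  simp only [scaledVar, map_zero, zero_mul, sub_zero, mul_one, map_one, one_mul] at h
  rcases lt_or_ge n 0 with hn | hn
  · simp [intCoeff_of_neg H hn, intCoeff_of_neg H (show n - 1 < 0 by omega)]
  · obtain ⟨n, rfl⟩ := Int.eq_ofNat_of_zero_le hn
    have h' := congrArg (PowerSeries.coeff n) h
    rw [mul_sub, mul_one, ← mul_assoc, map_sub, PowerSeries.coeff_map] at h'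
    rw [intCoeff_natCast]
    refine h'.trans ?_
    cases n with
    | zero => simp [intCoeff_of_neg]
    | succ n =>
      rw [PowerSeries.coeff_succ_mul_X, PowerSeries.coeff_mul_C, PowerSeries.coeff_map,
        PowerSeries.coeff_map, show ((n + 1 : ℕ) : ℤ) - 1 = (n : ℤ) by push_cast; ring,
        intCoeff_natCast]
      ring

/-- The Bernstein operator adds a first row to a Jacobi–Trudi determinant. -/
theorem IsComplete.bernstein_jacobiTrudi {r ρ : R} (hr : r * ρ = 1)
    {H : PowerSeries (MvPolynomial ℕ+ R)} (hH : IsComplete ρ H) {l : ℕ} (n : ℕ) (μ : Fin l → ℕ) :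
    bernstein r H n (jacobiTrudi H μ) = jacobiTrudi H (Fin.cons n μ : Fin (l + 1) → ℕ) := by
  -- the entries of the new determinant below its first row
  set N : Matrix (Fin l) (Fin (l + 1)) (MvPolynomial ℕ+ R) := Matrix.of fun i j =>
    intCoeff H ((μ i : ℤ) - ((i : ℕ) : ℤ) + ((j : ℕ) : ℤ) - 1) with hN
  have hB : jacobiTrudi H (Fin.cons n μ : Fin (l + 1) → ℕ) =
      ∑ j : Fin (l + 1), (-1) ^ (j : ℕ) * PowerSeries.coeff (n + j) H *
        (N.submatrix id j.succAbove).det := by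
    rw [jacobiTrudi, Matrix.det_succ_row_zero]
    refine Finset.sum_congr rfl fun j _ => ?_
    have h0 : PowerSeries.coeff (n + j) H = (Matrix.of fun i j : Fin (l + 1) => intCoeff H
        (((Fin.cons n μ : Fin (l + 1) → ℕ) i : ℤ) - ((i : ℕ) : ℤ) + ((j : ℕ) : ℤ))) 0 j := by
      rw [← intCoeff_natCast]
      simp
    rw [h0]
    congr 2
    ext1 i k
    simp only [Matrix.submatrix_apply, Matrix.of_apply, Fin.cons_succ, hN, id]
    congr 1
    simp
    ring
  -- with first row `1, v, v², …` column operations produce the shifted determinant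
  set A : Matrix (Fin (l + 1)) (Fin (l + 1)) (Polynomial (MvPolynomial ℕ+ R)) :=
    Matrix.of (Fin.cons (fun j => Polynomial.X ^ (j : ℕ)) fun i j => Polynomial.C (N i j)) with hA
  have hAdet : A.det = shift r 0 1 (jacobiTrudi H μ) := by
    rw [Matrix.det_eq_of_forall_col_eq_smul_add_pred (B := Matrix.of (Fin.cons
      (fun j => if j = 0 then 1 else 0) fun i => Fin.cons (Polynomial.C (N i 0))
        fun j => shift r 0 1 (intCoeff H ((μ i : ℤ) - ((i : ℕ) : ℤ) + ((j : ℕ) : ℤ)))))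
      (fun _ => Polynomial.X)]
    · rw [Matrix.det_succ_row_zero, Fin.sum_univ_succ]
      simp only [Matrix.of_apply, Fin.cons_zero, Fin.succ_ne_zero, if_true, if_false]
      simp only [mul_zero, zero_mul, Finset.sum_const_zero, add_zero, Fin.val_zero, pow_zero,
        one_mul, jacobiTrudi]
      rw [AlgHom.map_det]
      congr 1
    · intro i
      refine Fin.cases ?_ (fun i => ?_) i <;> simp [hA]
    · intro i j
      refine Fin.cases ?_ (fun i => ?_) i
      · simp [hA, pow_succ']
      · simp only [hA, Matrix.of_apply, Fin.cons_succ, hN]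
        rw [hH.shift_intCoeff hr]
        simp only [Fin.val_succ, Fin.val_castSucc]
        push_cast
        rw [show (μ i : ℤ) - (i : ℕ) + ((j : ℕ) + 1) - 1 = (μ i : ℤ) - (i : ℕ) + (j : ℕ) by ring]
        ring
  rw [bernstein, ← hAdet, Matrix.det_succ_row_zero, map_sum, hB]
  refine Finset.sum_congr rfl fun j _ => ?_
  have hminor : (A.submatrix Fin.succ j.succAbove).det =
      Polynomial.C (N.submatrix id j.succAbove).det := by
    rw [RingHom.map_det]
    rfl
  rw [hminor]
  have : (-1) ^ (j : ℕ) * A 0 j * Polynomial.C (N.submatrix id j.succAbove).det =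
      Polynomial.monomial (j : ℕ) ((-1) ^ (j : ℕ) * (N.submatrix id j.succAbove).det) := by
    rw [← Polynomial.C_mul_X_pow_eq_monomial]
    simp [hA]
  rw [this, pairing_monomial]
  ring

/-- Induction on the number of rows, by the commutation relation of the vertex operator with the
Bernstein operators. -/
theorem IsComplete.vertexOp_jacobiTrudi {r ρ : R} (hr : r * ρ = 1)
    {H : PowerSeries (MvPolynomial ℕ+ R)} (hH : IsComplete ρ H) {a b : R} (hab : a * b = 1)
    {l : ℕ} (μ : Fin l → ℕ) :
    vertexOp r a b H (jacobiTrudi H μ) =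
      MvPolynomial.C (vertexEigenvalue a b μ) * jacobiTrudi H μ := by
  induction l with
  | zero =>
    have : jacobiTrudi H μ = 1 := by simp [jacobiTrudi]
    rw [this, vertexOp, map_one, ← Polynomial.C_1, ← Polynomial.monomial_zero_left,
      pairing_monomial, PowerSeries.coeff_zero_eq_constantCoeff_apply,
      hH.constantCoeff_vertexSeries]
    simp [vertexEigenvalue]
  | succ l ih =>
    obtain ⟨n, μ, rfl⟩ : ∃ n, ∃ μ' : Fin l → ℕ, μ = Fin.cons n μ' :=
      ⟨μ 0, Fin.tail μ, (Fin.cons_self_tail μ).symm⟩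
    have hlin : ∀ c x, bernstein r H n (MvPolynomial.C c * x) =
        MvPolynomial.C c * bernstein r H n x := by
      intro c x
      rw [bernstein, map_mul, shift_C, ← Polynomial.smul_eq_C_mul, map_smul, smul_eq_mul]
      rfl
    rw [← hH.bernstein_jacobiTrudi hr, hH.vertexOp_bernstein hr hab, ih, hlin, ← mul_assoc,
      ← map_mul, ← add_mul, ← map_add]
    congr 2
    simp only [vertexEigenvalue, Fin.sum_univ_succ, Fin.cons_zero, Fin.cons_succ, Fin.val_succ,
      Fin.val_zero, mul_add, Finset.mul_sum]
    simp only [mul_zero, pow_zero, mul_one, pow_add]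
    have : ∀ i : Fin l, b ^ 2 * ((1 - b ^ 2) * (a ^ (2 * μ i) * b ^ (2 * (i : ℕ)))) =
        (1 - b ^ 2) * (a ^ (2 * μ i) * (b ^ (2 * (i : ℕ)) * b ^ 2)) := fun i => by ring
    simp only [this]
    ring

end JacobiTrudi

/-! ### Normally ordered exponentials -/

section NormalOrder

variable (u₀ ħ : ℂ)

theorem uHat_X_mul (k : ℤ) (j : ℕ+) (f : Fock) :
    uHat u₀ ħ k (MvPolynomial.X j * f) = MvPolynomial.X j * uHat u₀ ħ k f +
      if k = -(j : ℤ) then (ħ * (j : ℂ)) • f else 0 := by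
  match k with
  | Int.ofNat 0 =>
    have : ¬ (Int.ofNat 0 = -(j : ℤ)) := by
      have := j.pos
      simp
    rw [if_neg this]
    simp [uHat]
  | Int.ofNat (n + 1) =>
    have : ¬ (Int.ofNat (n + 1) = -(j : ℤ)) := by
      have := j.pos
      simp only [Int.ofNat_eq_natCast]
      omega
    rw [if_neg this]
    simp [uHat, qHat]
    ring
  | Int.negSucc n =>
    simp only [uHat, pHat, LinearMap.smul_apply, Derivation.coeFn_coe, Derivation.leibniz,
      smul_eq_mul, smul_add, mul_smul_comm]
    congr 1
    by_cases h : j = n.succPNat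
    · subst h
      rw [MvPolynomial.pderiv_X_self, if_pos (by simp [Int.negSucc_eq]), mul_one]
    · rw [MvPolynomial.pderiv_X_of_ne h, if_neg, mul_zero, smul_zero]
      intro h'
      apply h
      apply PNat.eq
      rw [Nat.succPNat_coe]
      rw [Int.negSucc_eq] at h'
      omega

/-- Moving `q_j` to the left through a normally ordered product of operators. -/
theorem list_prod_X_mul (j : ℕ+) (L : List ℤ) (hL : L.Pairwise fun a b => a ≥ b) (f : Fock) :
    (L.map (uHat u₀ ħ)).prod (MvPolynomial.X j * f) =
      MvPolynomial.X j * (L.map (uHat u₀ ħ)).prod f +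
        (ħ * (j : ℂ) * (L.count (-(j : ℤ)) : ℂ)) •
          ((L.erase (-(j : ℤ))).map (uHat u₀ ħ)).prod f := by
  induction L with
  | nil => simp
  | cons a t ih =>
    rw [List.pairwise_cons] at hL
    simp only [List.map_cons, List.prod_cons, Module.End.mul_apply]
    rw [ih hL.2, map_add, map_smul, uHat_X_mul, add_assoc]
    congr 1
    by_cases ha : a = -(j : ℤ)
    · subst ha
      rw [if_pos rfl, List.erase_cons_head, List.count_cons_self]
      by_cases hmem : -(j : ℤ) ∈ t
      · -- the head of the remaining list equals `-j`, by monotonicity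
        obtain ⟨b, t', rfl⟩ := List.exists_cons_of_ne_nil (List.ne_nil_of_mem hmem)
        have hb : b = -(j : ℤ) := by
          refine le_antisymm (hL.1 b (by simp)) ?_
          rcases List.mem_cons.1 hmem with h | h
          · exact h.le
          · exact (List.pairwise_cons.1 hL.2).1 _ h
        subst hb
        rw [List.erase_cons_head, List.map_cons, List.prod_cons, Module.End.mul_apply, ← add_smul]
        congr 1
        push_cast
        ring
      · rw [List.count_eq_zero_of_not_mem hmem]
        simp
    · rw [if_neg ha, zero_add, List.erase_cons_tail (by simpa using ha),
        List.count_cons_of_ne ha]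
      simp

/-- The vacuum expectation of `u_k`: the result of applying `uHat` to `1`. -/
noncomputable def vacuum : ℤ → Fock
  | Int.ofNat 0 => MvPolynomial.C u₀
  | Int.ofNat (n + 1) => MvPolynomial.X n.succPNat
  | Int.negSucc _ => 0

theorem uHat_of_nonneg {k : ℤ} (hk : 0 ≤ k) (f : Fock) :
    uHat u₀ ħ k f = vacuum u₀ k * f := by
  match k with
  | Int.ofNat 0 => simp [uHat, vacuum, MvPolynomial.smul_eq_C_mul]
  | Int.ofNat (n + 1) => simp [uHat, vacuum, qHat]

theorem uHat_of_neg_one {k : ℤ} (hk : k < 0) : uHat u₀ ħ k 1 = 0 := by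
  match k with
  | Int.negSucc n => simp [uHat, pHat]

theorem vacuum_of_neg {k : ℤ} (hk : k < 0) : vacuum u₀ k = 0 := by
  match k with
  | Int.negSucc n => rfl

/-- A normally ordered product applied to `1` is the product of the vacuum expectations. -/
theorem list_prod_one (L : List ℤ) (hL : L.Pairwise fun a b => a ≥ b) :
    (L.map (uHat u₀ ħ)).prod 1 = (L.map (vacuum u₀)).prod := by
  induction L with
  | nil => simp
  | cons a t ih =>
    rw [List.pairwise_cons] at hL
    simp only [List.map_cons, List.prod_cons, Module.End.mul_apply]
    rcases lt_or_ge a 0 with ha | ha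
    · rw [vacuum_of_neg u₀ ha, zero_mul]
      cases t with
      | nil => simpa using uHat_of_neg_one u₀ ħ ha
      | cons b t =>
        have hb : b < 0 := (hL.1 b (by simp)).trans_lt ha
        rw [ih hL.2, List.map_cons, List.prod_cons, vacuum_of_neg u₀ hb, zero_mul, map_zero]
    · rw [ih hL.2, uHat_of_nonneg u₀ ħ ha]

theorem normalOrder_monomial (m : ℤ →₀ ℕ) :
    normalOrder u₀ ħ (MvPolynomial.monomial m 1) =
      (((Finsupp.toMultiset m).sort (fun a b => a ≥ b)).map (uHat u₀ ħ)).prod := by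
  rw [show (MvPolynomial.monomial m 1 : MvPolynomial ℤ ℂ) = MvPolynomial.basisMonomials ℤ ℂ m by
    rw [MvPolynomial.coe_basisMonomials], normalOrder, Module.Basis.constr_basis]

theorem normalOrder_monomial_X_mul (m : ℤ →₀ ℕ) (j : ℕ+) (f : Fock) :
    normalOrder u₀ ħ (MvPolynomial.monomial m 1) (MvPolynomial.X j * f) =
      MvPolynomial.X j * normalOrder u₀ ħ (MvPolynomial.monomial m 1) f +
        (ħ * (j : ℂ) * (m (-(j : ℤ)) : ℂ)) •
          normalOrder u₀ ħ (MvPolynomial.monomial (m - Finsupp.single (-(j : ℤ)) 1) 1) f := by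
  rw [normalOrder_monomial, normalOrder_monomial,
    list_prod_X_mul u₀ ħ j _ (Multiset.pairwise_sort _ _)]
  have hc : ((Finsupp.toMultiset m).sort (fun a b => a ≥ b)).count (-(j : ℤ)) = m (-(j : ℤ)) := by
    rw [← Multiset.coe_count, Multiset.sort_eq, Finsupp.count_toMultiset]
  have he : ((Finsupp.toMultiset m).sort (fun a b => a ≥ b)).erase (-(j : ℤ)) =
      (Finsupp.toMultiset (m - Finsupp.single (-(j : ℤ)) 1)).sort (fun a b => a ≥ b) := by
    refine List.Perm.eq_of_pairwise (le := fun a b => a ≥ b)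
      (fun a b _ _ h1 h2 => le_antisymm h2 h1) ?_ (Multiset.pairwise_sort _ _) ?_
    · exact (Multiset.pairwise_sort _ _).sublist List.erase_sublist
    · rw [← Multiset.coe_eq_coe, ← Multiset.coe_erase, Multiset.sort_eq, Multiset.sort_eq]
      ext a
      rw [Finsupp.count_toMultiset, Finsupp.tsub_apply]
      by_cases ha : a = -(j : ℤ)
      · subst ha
        simp
      · rw [Multiset.count_erase_of_ne ha, Finsupp.count_toMultiset,
          Finsupp.single_eq_of_ne ha, Nat.sub_zero]
  rw [hc, he]

theorem normalOrder_monomial_one (m : ℤ →₀ ℕ) :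
    normalOrder u₀ ħ (MvPolynomial.monomial m 1) 1 = m.prod fun k e => vacuum u₀ k ^ e := by
  rw [normalOrder_monomial, list_prod_one _ _ _ (Multiset.pairwise_sort _ _),
    ← Multiset.prod_coe, ← Multiset.map_coe, Multiset.sort_eq, Finsupp.toMultiset_map,
    Finsupp.prod_toMultiset, Finsupp.prod_mapDomain_index (by simp) (by simp [pow_add])]

end NormalOrder

section Extension

variable (u₀ ħ : ℂ) {S : Type*} [CommRing S] (ι : Fock →+* S)

/-- The `S`-linear extension of the map `P ↦ ι (:P: f)`, where `:P:` is the normally ordered operator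
of the symbol `P`, to symbols with coefficients in `S`. -/
noncomputable def normalOrderApply (f : Fock) : MvPolynomial ℤ S →ₗ[S] S :=
  (MvPolynomial.basisMonomials ℤ S).constr S fun m =>
    ι (normalOrder u₀ ħ (MvPolynomial.monomial m 1) f)

theorem normalOrderApply_monomial (f : Fock) (m : ℤ →₀ ℕ) (s : S) :
    normalOrderApply u₀ ħ ι f (MvPolynomial.monomial m s) =
      s * ι (normalOrder u₀ ħ (MvPolynomial.monomial m 1) f) := by
  rw [show MvPolynomial.monomial m s = s • MvPolynomial.basisMonomials ℤ S m by
    simp [MvPolynomial.smul_monomial], map_smul, normalOrderApply, Module.Basis.constr_basis,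
    smul_eq_mul]

theorem normalOrderApply_add (f g : Fock) (P : MvPolynomial ℤ S) :
    normalOrderApply u₀ ħ ι (f + g) P =
      normalOrderApply u₀ ħ ι f P + normalOrderApply u₀ ħ ι g P := by
  induction P using MvPolynomial.induction_on' with
  | monomial m s => simp only [normalOrderApply_monomial, map_add, mul_add]
  | add P Q hP hQ => rw [map_add, map_add, map_add, hP, hQ]; ring

theorem normalOrderApply_C_mul (c : ℂ) (f : Fock) (P : MvPolynomial ℤ S) :
    normalOrderApply u₀ ħ ι (MvPolynomial.C c * f) P =
      ι (MvPolynomial.C c) * normalOrderApply u₀ ħ ι f P := by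
  induction P using MvPolynomial.induction_on' with
  | monomial m s =>
    rw [normalOrderApply_monomial, normalOrderApply_monomial, ← MvPolynomial.smul_eq_C_mul,
      map_smul, MvPolynomial.smul_eq_C_mul, map_mul]
    ring
  | add P Q hP hQ => rw [map_add, map_add, hP, hQ]; ring

theorem normalOrderApply_X_mul (j : ℕ+) (f : Fock) (P : MvPolynomial ℤ S) :
    normalOrderApply u₀ ħ ι (MvPolynomial.X j * f) P =
      ι (MvPolynomial.X j) * normalOrderApply u₀ ħ ι f P +
        ι (MvPolynomial.C (ħ * j)) *
          normalOrderApply u₀ ħ ι f (MvPolynomial.pderiv (-(j : ℤ)) P) := by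
  induction P using MvPolynomial.induction_on' with
  | monomial m s =>
    rw [MvPolynomial.pderiv_monomial, normalOrderApply_monomial, normalOrderApply_monomial,
      normalOrderApply_monomial, normalOrder_monomial_X_mul, map_add, map_mul,
      MvPolynomial.smul_eq_C_mul, map_mul, map_mul, map_mul]
    simp only [map_natCast]
    ring
  | add P Q hP hQ => rw [map_add, map_add, map_add, map_add, hP, hQ]; ring

theorem normalOrderApply_one (P : MvPolynomial ℤ S) :
    normalOrderApply u₀ ħ ι 1 P = MvPolynomial.aeval (fun k => ι (vacuum u₀ k)) P := by
  induction P using MvPolynomial.induction_on' with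
  | monomial m s =>
    rw [normalOrderApply_monomial, normalOrder_monomial_one, MvPolynomial.aeval_monomial,
      Finsupp.prod, map_prod]
    simp [Finsupp.prod]
  | add P Q hP hQ => rw [map_add, map_add, hP, hQ]

end Extension

section TruncatedExp

variable (u₀ ħ : ℂ) {S : Type*} [CommRing S] (ι : Fock →+* S)

/-- The symbol `∑_{k ∈ s} c_k u_k`. -/
noncomputable def linSymbol (s : Finset ℤ) (c : ℤ → S) : MvPolynomial ℤ S :=
  ∑ k ∈ s, MvPolynomial.C (c k) * MvPolynomial.X k

/-- The exponential of `x`, truncated after `M` terms. -/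
noncomputable def truncExp (M : ℕ) (x : S) : S :=
  ∑ n ∈ Finset.range M, ι (MvPolynomial.C (1 / (n.factorial : ℂ))) * x ^ n

/-- The normally ordered exponential of `∑_{k ∈ s} c_k u_k`, truncated after `M` terms and applied
to `f`. -/
noncomputable def normalOrderExp (M : ℕ) (s : Finset ℤ) (c : ℤ → S) (f : Fock) : S :=
  ∑ n ∈ Finset.range M, ι (MvPolynomial.C (1 / (n.factorial : ℂ))) *
    normalOrderApply u₀ ħ ι f (linSymbol s c ^ n)

theorem inv_factorial_succ_mul (n : ℕ) :
    ι (MvPolynomial.C (1 / ((n + 1).factorial : ℂ))) * (n + 1 : ℕ) =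
      ι (MvPolynomial.C (1 / (n.factorial : ℂ))) := by
  rw [← map_natCast ι, ← map_natCast MvPolynomial.C, ← map_mul, ← map_mul]
  congr 2
  have : ((n : ℂ) + 1) ≠ 0 := by exact_mod_cast Nat.succ_ne_zero n
  have h2 : (n.factorial : ℂ) ≠ 0 := by exact_mod_cast n.factorial_ne_zero
  rw [Nat.factorial_succ]
  push_cast
  field_simp

theorem pderiv_linSymbol (s : Finset ℤ) (c : ℤ → S) (j : ℤ) :
    MvPolynomial.pderiv j (linSymbol s c) = MvPolynomial.C (if j ∈ s then c j else 0) := by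
  rw [linSymbol, map_sum]
  simp only [MvPolynomial.pderiv_C_mul]
  by_cases hj : j ∈ s
  · rw [Finset.sum_eq_single_of_mem j hj]
    · simp [hj]
    · intro k _ hk
      rw [MvPolynomial.pderiv_X_of_ne hk, mul_zero]
  · rw [if_neg hj, map_zero]
    refine Finset.sum_eq_zero fun k hk => ?_
    rw [MvPolynomial.pderiv_X_of_ne (by rintro rfl; exact hj hk), mul_zero]

theorem normalOrderExp_X_mul (M : ℕ) (s : Finset ℤ) (c : ℤ → S) (j : ℕ+) (f : Fock) :
    normalOrderExp u₀ ħ ι (M + 1) s c (MvPolynomial.X j * f) =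
      ι (MvPolynomial.X j) * normalOrderExp u₀ ħ ι (M + 1) s c f +
        ι (MvPolynomial.C (ħ * j)) * (if -(j : ℤ) ∈ s then c (-(j : ℤ)) else 0) *
          normalOrderExp u₀ ħ ι M s c f := by
  simp only [normalOrderExp, normalOrderApply_X_mul, mul_add, Finset.sum_add_distrib]
  congr 1
  · rw [Finset.mul_sum]
    exact Finset.sum_congr rfl fun n _ => by ring
  · rw [Finset.sum_range_succ', Finset.mul_sum]
    simp only [pow_zero, MvPolynomial.pderiv_one, map_zero, mul_zero, add_zero]
    refine Finset.sum_congr rfl fun n _ => ?_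
    rw [MvPolynomial.pderiv_pow, pderiv_linSymbol, Nat.add_sub_cancel,
      ← inv_factorial_succ_mul ι n]
    set d := (if -(j : ℤ) ∈ s then c (-(j : ℤ)) else 0)
    rw [show ((n + 1 : ℕ) : MvPolynomial ℤ S) * linSymbol s c ^ n * MvPolynomial.C d =
      (((n + 1 : ℕ) : S) * d) • linSymbol s c ^ n by
        rw [MvPolynomial.smul_eq_C_mul, map_mul, map_natCast]; ring, map_smul, smul_eq_mul]
    ring

/-- Modulo `z^M`, the normally ordered exponential of `∑ c_k u_k` with all `c_k` divisible by `z`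
multiplies by the exponential of `∑_{k ≥ 0} c_k u_k` and substitutes `q_j + ħ j c_{-j}` for `q_j`. -/
theorem pow_dvd_normalOrderExp_sub {z : S} (M : ℕ) (s : Finset ℤ) (c : ℤ → S)
    (hc : ∀ k, z ∣ c k) (sh : Fock →+* S) (hC : ∀ x, sh (MvPolynomial.C x) = ι (MvPolynomial.C x))
    (hX : ∀ j : ℕ+, sh (MvPolynomial.X j) = ι (MvPolynomial.X j) +
      ι (MvPolynomial.C (ħ * j)) * (if -(j : ℤ) ∈ s then c (-(j : ℤ)) else 0)) (f : Fock) :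
    z ^ M ∣ normalOrderExp u₀ ħ ι M s c f -
      truncExp ι M (∑ k ∈ s, c k * ι (vacuum u₀ k)) * sh f := by
  have hz : ∀ f, ∀ n, z ^ n ∣ normalOrderApply u₀ ħ ι f (linSymbol s c ^ n) := by
    intro f n
    choose c' hc' using hc
    have : linSymbol s c = z • linSymbol s c' := by
      rw [linSymbol, linSymbol, Finset.smul_sum]
      refine Finset.sum_congr rfl fun k _ => ?_
      rw [hc', MvPolynomial.smul_eq_C_mul, map_mul, mul_assoc]
    rw [this, smul_pow, map_smul, smul_eq_mul]
    exact dvd_mul_right _ _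
  cases M with
  | zero => simp
  | succ M =>
  induction f using MvPolynomial.induction_on with
  | C x =>
    have : normalOrderExp u₀ ħ ι (M + 1) s c (MvPolynomial.C x) =
        truncExp ι (M + 1) (∑ k ∈ s, c k * ι (vacuum u₀ k)) * sh (MvPolynomial.C x) := by
      rw [normalOrderExp, truncExp, Finset.sum_mul, hC]
      refine Finset.sum_congr rfl fun n _ => ?_
      rw [← mul_one (MvPolynomial.C x), normalOrderApply_C_mul, normalOrderApply_one, map_pow,
        linSymbol, map_sum]
      simp
      ring
    rw [this, sub_self]
    exact dvd_zero _
  | add p q hp hq =>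
    have : normalOrderExp u₀ ħ ι (M + 1) s c (p + q) = normalOrderExp u₀ ħ ι (M + 1) s c p +
        normalOrderExp u₀ ħ ι (M + 1) s c q := by
      simp only [normalOrderExp, normalOrderApply_add, mul_add, Finset.sum_add_distrib]
    rw [this, map_add]
    convert! dvd_add hp hq using 1
    ring
  | mul_X p j hp =>
    rw [mul_comm p, normalOrderExp_X_mul, map_mul sh, hX]
    set d := (if -(j : ℤ) ∈ s then c (-(j : ℤ)) else 0) with hd
    have hzd : z ∣ d := by
      rw [hd]
      split_ifs
      · exact hc _
      · exact dvd_zero _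
    have hlast : z ^ (M + 1) ∣ d * (normalOrderExp u₀ ħ ι (M + 1) s c p -
        normalOrderExp u₀ ħ ι M s c p) := by
      rw [normalOrderExp, normalOrderExp, Finset.sum_range_succ, add_sub_cancel_left, pow_succ']
      exact mul_dvd_mul hzd (Dvd.dvd.mul_left (hz p M) _)
    convert! dvd_sub (Dvd.dvd.mul_left hp (ι (MvPolynomial.X j) + ι (MvPolynomial.C (ħ * j)) * d))
      (Dvd.dvd.mul_left hlast (ι (MvPolynomial.C (ħ * j)))) using 1
    ring

end TruncatedExp

/-! ### The Fourier modes and the constant term -/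

section Modes

open PowerSeries

/-- The series `e^{x z}`. -/
noncomputable def expSeries (x : ℂ) : PowerSeries ℂ := rescale x (PowerSeries.exp ℂ)

theorem expSeries_mul (x y : ℂ) : expSeries x * expSeries y = expSeries (x + y) :=
  exp_mul_exp_eq_exp_add x y

theorem expSeries_zero : expSeries 0 = 1 := by
  simp [expSeries, rescale_zero]

theorem expSeries_pow (x : ℂ) (n : ℕ) : expSeries x ^ n = expSeries (n * x) := by
  induction n with
  | zero => simp [expSeries_zero]
  | succ n ih =>
    rw [pow_succ, ih, expSeries_mul]
    congr 1
    push_cast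
    ring

theorem coeff_expSeries (x : ℂ) (n : ℕ) : coeff n (expSeries x) = x ^ n / n.factorial := by
  rw [expSeries, coeff_rescale, coeff_exp]
  simp [div_eq_mul_inv]

theorem C_mul_modeFactor (r : ℂ) (k : ℤ) :
    C (r * k) * modeFactor r k = expSeries (r * k / 2) - expSeries (-(r * k / 2)) := by
  have hI : Complex.I * r * (Complex.I * (k : ℂ)) = -(r * k) := by
    linear_combination (r * k) * Complex.I_mul_I
  have h := congrArg (rescale (-(r * (k : ℂ)))) X_mul_sSeries
  rw [map_mul, rescale_X, map_sub, rescale_rescale, rescale_rescale] at h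
  rw [modeFactor, hI, expSeries, expSeries]
  rw [show 1 / 2 * -(r * (k : ℂ)) = -(r * k / 2) by ring,
    show -1 / 2 * -(r * (k : ℂ)) = r * k / 2 by ring, map_neg] at h
  linear_combination -h

theorem modeFactor_neg (r : ℂ) (k : ℤ) : modeFactor r (-k) = modeFactor r k := by
  rcases eq_or_ne (r * k) 0 with h | h
  · rw [modeFactor, modeFactor]
    push_cast
    congr 3
    linear_combination (-2 * Complex.I ^ 2) * h
  · have h1 := C_mul_modeFactor r k
    have h2 := C_mul_modeFactor r (-k)
    have hC : C (r * k) * C (r * k)⁻¹ = (1 : PowerSeries ℂ) := by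
      rw [← map_mul, mul_inv_cancel₀ h, map_one]
    push_cast at h2
    rw [show r * -(k : ℂ) / 2 = -(r * k / 2) by ring, neg_neg, mul_neg, map_neg] at h2
    linear_combination (modeFactor r k - modeFactor r (-k)) * hC - C (r * k)⁻¹ * h1
      - C (r * k)⁻¹ * h2

theorem modeFactor_zero (r : ℂ) : modeFactor r 0 = PowerSeries.X := by
  simp [modeFactor, rescale_zero, constantCoeff_sSeries]

theorem X_dvd_modeFactor (r : ℂ) (k : ℤ) : PowerSeries.X ∣ modeFactor r k := Dvd.intro _ rfl

/-- `r k` times the factor of the `k`-th mode is `a^k - b^k` with `a = e^{rz/2}` and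
`b = e^{-rz/2}`. -/
theorem C_mul_modeFactor_natCast (r : ℂ) (k : ℕ) :
    C (r * k) * modeFactor r k = expSeries (r / 2) ^ k - expSeries (-(r / 2)) ^ k := by
  have h := C_mul_modeFactor r k
  rw [expSeries_pow, expSeries_pow]
  have hk : (k : ℂ) * (r / 2) = r * ((k : ℤ) : ℂ) / 2 := by push_cast; ring
  rw [mul_neg, hk, ← h]
  simp

end Modes

section Formal

open Polynomial

variable {R : Type*} [CommRing R] (e : PowerSeries ℂ ≃+* R)

/-- The inclusion of `ℂ[q₁, q₂, …]` into `ℂ⟦z⟧[q₁, q₂, …]`, with the scalars `ℂ⟦z⟧` transported along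
an isomorphism. -/
noncomputable def toSeries : Fock →+* MvPolynomial ℕ+ R :=
  MvPolynomial.map ((e : PowerSeries ℂ →+* R).comp PowerSeries.C)

/-- The coefficient of `u_k` in the exponent: the factor of the `k`-th mode times `y^k` for
`k ≥ 0` or `v^{-k}` for `k ≤ 0`, where `v` stands for `1/y`. -/
noncomputable def modeCoeff (r : ℂ) (k : ℤ) : (MvPolynomial ℕ+ R)[X][X] :=
  monomial (-k).toNat (monomial k.toNat (MvPolynomial.C (e (modeFactor r k))))

/-- The constant term in `y`, for `v = 1/y`: the linear functional on polynomials in `y` and `v` with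
`y^i v^j ↦ δ_{ij}`. -/
noncomputable def constTerm {A : Type*} [CommRing A] : A[X][X] →ₗ[A] A :=
  pairing₂ fun k m => if k = m then 1 else 0

theorem constTerm_C_mul_map {A : Type*} [CommRing A] (p d : A[X]) :
    constTerm (C p * d.map C) = pairing p.coeff d := by
  induction d using Polynomial.induction_on' with
  | add d e hd he => rw [Polynomial.map_add, mul_add, map_add, hd, he, map_add]
  | monomial m c =>
    rw [Polynomial.map_monomial, C_mul_monomial, constTerm, pairing₂_monomial, pairing_monomial]
    induction p using Polynomial.induction_on' with
    | add p q hp hq => rw [add_mul, map_add, hp, hq, coeff_add, mul_add]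
    | monomial n b =>
      rw [monomial_mul_C, pairing_monomial, coeff_monomial]
      by_cases h : m = n
      · subst h; simp [mul_comm]
      · simp [h, Ne.symm h]

theorem constTerm_C_C_mul {A : Type*} [CommRing A] (x : A) (p : A[X][X]) :
    constTerm (C (C x) * p) = x * constTerm p := by
  have : C (C x) * p = x • p := by
    ext i j
    simp
  rw [this, map_smul, smul_eq_mul]

theorem constTerm_monomial {A : Type*} [CommRing A] (k m : ℕ) (x : A) :
    constTerm (monomial k (monomial m x)) = if k = m then x else 0 := by
  simp [constTerm]

/-- The exponential series, integrated over the circle and truncated, as a constant term. -/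
theorem coeff_expIntegral_apply (u₀ ħ r : ℂ) (f : Fock) (m : ℕ) (d : ℕ+ →₀ ℕ) :
    ∀ᶠ K : ℕ in Filter.atTop, MvPolynomial.coeff d (PowerSeries.coeff m (expIntegral u₀ ħ r) f) =
      PowerSeries.coeff m (e.symm (MvPolynomial.coeff d (constTerm (normalOrderExp u₀ ħ
        ((C.comp C).comp (toSeries e)) (m + 1) (Finset.Icc (-(K : ℤ)) K) (modeCoeff e r) f)))) := by
  have hK : ∀ᶠ K : ℕ in Filter.atTop, ∀ n ∈ Finset.range (m + 1),
      (Function.support fun k : Fin n → ℤ => term u₀ ħ r m k f) ⊆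
        Fintype.piFinset fun _ : Fin n => Finset.Icc (-(K : ℤ)) K := by
    rw [Filter.eventually_all_finset]
    intro n _
    have hfin := term_finite u₀ ħ r m n f
    have h1 : ∀ᶠ K : ℕ in Filter.atTop, ∀ k ∈ hfin.toFinset, ∀ i ∈ (Finset.univ : Finset (Fin n)),
        (k i).natAbs ≤ K := by
      rw [Filter.eventually_all_finset]
      intro k _
      rw [Filter.eventually_all_finset]
      intro i _
      exact Filter.eventually_ge_atTop _
    filter_upwards [h1] with K hK k hk
    rw [Finset.mem_coe, Fintype.mem_piFinset]
    intro i
    have := hK k (hfin.mem_toFinset.2 hk) i (Finset.mem_univ i)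
    rw [Finset.mem_Icc]
    omega
  filter_upwards [hK] with K hK
  rw [expIntegral, PowerSeries.coeff_mk, LinearMap.sum_apply, normalOrderExp, map_sum,
    MvPolynomial.coeff_sum, MvPolynomial.coeff_sum, map_sum, map_sum]
  refine Finset.sum_congr rfl fun n hn => ?_
  rw [LinearMap.smul_apply, MvPolynomial.coeff_smul]
  have hterm : locFinSum (fun k : Fin n → ℤ => term u₀ ħ r m k) (term_finite u₀ ħ r m n) f =
      ∑ k ∈ Fintype.piFinset fun _ : Fin n => Finset.Icc (-(K : ℤ)) K, term u₀ ħ r m k f :=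
    finsum_eq_sum_of_support_subset _ (hK n hn)
  have hpow : linSymbol (Finset.Icc (-(K : ℤ)) K) (modeCoeff e r) ^ n =
      ∑ k ∈ Fintype.piFinset fun _ : Fin n => Finset.Icc (-(K : ℤ)) K,
        MvPolynomial.monomial (∑ i, Finsupp.single (k i) 1) (∏ i, modeCoeff e r (k i)) := by
    rw [linSymbol, Finset.sum_pow']
    refine Finset.sum_congr rfl fun k _ => ?_
    rw [Finset.prod_mul_distrib, ← map_prod, ← mul_one (∏ i, modeCoeff e r (k i)),
      ← MvPolynomial.C_mul_monomial, MvPolynomial.monomial_sum_one, mul_one]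
    rfl
  rw [hterm, hpow, map_sum, Finset.mul_sum, map_sum, MvPolynomial.coeff_sum, MvPolynomial.coeff_sum,
    map_sum, map_sum, Finset.smul_sum]
  refine Finset.sum_congr rfl fun k _ => ?_
  have hprod : ∀ s : Finset (Fin n), ∏ i ∈ s, modeCoeff e r (k i) =
      monomial (∑ i ∈ s, (-(k i)).toNat) (monomial (∑ i ∈ s, (k i).toNat)
        (MvPolynomial.C (e (∏ i ∈ s, modeFactor r (k i))))) := by
    intro s
    induction s using Finset.induction_on with
    | empty => simp
    | insert i s hi ih =>
      rw [Finset.prod_insert hi, ih, Finset.sum_insert hi, Finset.sum_insert hi,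
        Finset.prod_insert hi, modeCoeff, monomial_mul_monomial, monomial_mul_monomial,
        map_mul e, map_mul MvPolynomial.C]
  have hsum : ∑ i, (-(k i)).toNat = ∑ i, (k i).toNat ↔ ∑ i, k i = 0 := by
    have : ∑ i, k i = ((∑ i, (k i).toNat : ℕ) : ℤ) - ((∑ i, (-(k i)).toNat : ℕ) : ℤ) := by
      push_cast
      rw [← Finset.sum_sub_distrib]
      refine Finset.sum_congr rfl fun i _ => ?_
      omega
    omega
  have hX : (∏ i, MvPolynomial.X (k i) : MvPolynomial ℤ ℂ) =
      MvPolynomial.monomial (∑ i, Finsupp.single (k i) 1) 1 :=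
    (MvPolynomial.monomial_sum_one _ _).symm
  rw [normalOrderApply_monomial, hprod, term, hX, circleMean_eq]
  set G := normalOrder u₀ ħ (MvPolynomial.monomial (∑ i, Finsupp.single (k i) 1) 1) f
  simp only [RingHom.comp_apply]
  rw [constTerm_C_C_mul, mul_comm _ (C (C (toSeries e G))), constTerm_C_C_mul, constTerm_monomial]
  simp only [hsum]
  split_ifs with h0
  · have : toSeries e (MvPolynomial.C (1 / (n.factorial : ℂ))) =
        MvPolynomial.C (e (PowerSeries.C (1 / (n.factorial : ℂ)))) := by
      simp [toSeries]
    rw [this, mul_comm (toSeries e G), MvPolynomial.coeff_C_mul, MvPolynomial.coeff_C_mul, toSeries,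
      MvPolynomial.coeff_map, RingHom.comp_apply, RingEquiv.coe_toRingHom, ← map_mul, ← map_mul,
      RingEquiv.symm_apply_apply, PowerSeries.coeff_C_mul, PowerSeries.coeff_mul_C]
    simp [G]
  · simp

end Formal

/-! ### The vacuum part of the exponential -/

section VacuumPart

open Polynomial

variable {R : Type*} [CommRing R] (e : PowerSeries ℂ ≃+* R)

theorem toSeries_C (x : ℂ) :
    toSeries e (MvPolynomial.C x) = MvPolynomial.C (e (PowerSeries.C x)) := by
  simp [toSeries]

theorem toSeries_X (j : ℕ+) : toSeries e (MvPolynomial.X j) = MvPolynomial.X j := by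
  simp [toSeries]

/-- The vacuum expectation `∑_{k=0}^K φ_k q_k y^k` of the exponent, where `q₀ = u₀`. -/
noncomputable def vacuumExponent (u₀ r : ℂ) (K : ℕ) : (MvPolynomial ℕ+ R)[X] :=
  ∑ k ∈ Finset.range (K + 1),
    monomial k (MvPolynomial.C (e (modeFactor r k)) * toSeries e (vacuum u₀ k))

theorem coeff_vacuumExponent (u₀ r : ℂ) {K k : ℕ} (hk : k ≤ K) :
    (vacuumExponent e u₀ r K).coeff k =
      MvPolynomial.C (e (modeFactor r k)) * toSeries e (vacuum u₀ k) := by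
  rw [vacuumExponent, finsetSum_coeff, Finset.sum_eq_single_of_mem k (by simp; omega)]
  · simp
  · intro j _ hj
    rw [coeff_monomial, if_neg hj]

theorem sum_modeCoeff_mul_vacuum (u₀ r : ℂ) (K : ℕ) :
    ∑ k ∈ Finset.Icc (-(K : ℤ)) K, modeCoeff e r k *
      ((C.comp C).comp (toSeries e)) (vacuum u₀ k) = C (vacuumExponent e u₀ r K) := by
  have hsub : (Finset.range (K + 1)).map Nat.castEmbedding ⊆ Finset.Icc (-(K : ℤ)) K := by
    intro k hk
    simp only [Finset.mem_map, Finset.mem_range, Nat.castEmbedding_apply] at hk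
    obtain ⟨n, hn, rfl⟩ := hk
    rw [Finset.mem_Icc]
    omega
  rw [← Finset.sum_subset hsub, Finset.sum_map, vacuumExponent, map_sum]
  · refine Finset.sum_congr rfl fun k _ => ?_
    simp only [modeCoeff, RingHom.comp_apply, Nat.castEmbedding_apply, Int.toNat_natCast]
    rw [show (-(k : ℤ)).toNat = 0 by omega, monomial_zero_left, ← C_mul, monomial_mul_C]
  · intro k hk hk'
    have : k < 0 := by
      by_contra hneg
      apply hk'
      simp only [Finset.mem_map, Finset.mem_range, Nat.castEmbedding_apply]
      rw [Finset.mem_Icc] at hk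
      exact ⟨k.toNat, by omega, by omega⟩
    rw [vacuum_of_neg u₀ this, map_zero, mul_zero]

theorem map_truncExp {S T : Type*} [CommRing S] [CommRing T] (ι : Fock →+* S) (φ : S →+* T) (M : ℕ)
    (x : S) : φ (truncExp ι M x) = truncExp (φ.comp ι) M (φ x) := by
  simp only [truncExp, map_sum, map_mul, map_pow, RingHom.comp_apply]

theorem derivative_truncExp (M : ℕ) (p : (MvPolynomial ℕ+ R)[X]) :
    derivative (truncExp (C.comp (toSeries e)) (M + 1) p) =
      derivative p * truncExp (C.comp (toSeries e)) M p := by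
  rw [truncExp, truncExp, Finset.sum_range_succ', derivative_add, derivative_sum, Finset.mul_sum]
  simp only [pow_zero, mul_one, RingHom.comp_apply, derivative_C, add_zero]
  refine Finset.sum_congr rfl fun n _ => ?_
  rw [derivative_mul, derivative_C, zero_mul, zero_add, derivative_pow]
  have := inv_factorial_succ_mul (C.comp (toSeries e)) n
  rw [RingHom.comp_apply, RingHom.comp_apply] at this
  rw [← this, map_natCast]
  simp only [Nat.add_sub_cancel]
  ring

theorem X_pow_dvd_truncExp_sub (u₀ : ℂ) (M : ℕ) :
    (MvPolynomial.C (e PowerSeries.X) : MvPolynomial ℕ+ R) ^ M ∣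
      truncExp (toSeries e) M (MvPolynomial.C (e (PowerSeries.X * PowerSeries.C u₀))) -
        MvPolynomial.C (e (expSeries u₀)) := by
  have h : truncExp (toSeries e) M (MvPolynomial.C (e (PowerSeries.X * PowerSeries.C u₀))) =
      MvPolynomial.C (e (∑ n ∈ Finset.range M, PowerSeries.C (1 / (n.factorial : ℂ)) *
        (PowerSeries.X * PowerSeries.C u₀) ^ n)) := by
    simp only [truncExp, toSeries_C, map_sum, map_mul, map_pow]
  rw [h, ← map_sub, ← map_sub, ← map_pow, ← map_pow]
  refine _root_.map_dvd _ (_root_.map_dvd e (PowerSeries.X_pow_dvd_iff.2 fun m hm => ?_))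
  rw [map_sub, map_sum, coeff_expSeries, Finset.sum_eq_single_of_mem m (by simpa using hm)]
  · rw [mul_pow, ← map_pow, PowerSeries.coeff_C_mul, PowerSeries.coeff_mul_C,
      PowerSeries.coeff_X_pow_self]
    ring
  · intro n _ hn
    rw [mul_pow, ← map_pow, PowerSeries.coeff_C_mul, PowerSeries.coeff_mul_C,
      PowerSeries.coeff_X_pow, if_neg (Ne.symm hn)]
    ring

theorem C_dvd_vacuumExponent (u₀ r : ℂ) (K : ℕ) :
    C (MvPolynomial.C (e PowerSeries.X)) ∣ vacuumExponent e u₀ r K := by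
  refine Finset.dvd_sum fun k _ => ?_
  rw [← C_mul_X_pow_eq_monomial]
  exact Dvd.dvd.mul_right (_root_.map_dvd C (Dvd.dvd.mul_right
    (_root_.map_dvd MvPolynomial.C (_root_.map_dvd e (X_dvd_modeFactor r k))) _)) _

/-- The coefficients of the exponential of the vacuum exponent are those of
`e^{z u₀} H(a y) / H(b y)`, modulo `z^M`: both satisfy the same recursion. -/
theorem pow_dvd_coeff_truncExp_sub (u₀ : ℂ) {r : ℂ} (hr : r ≠ 0)
    {H : PowerSeries (MvPolynomial ℕ+ R)} (hH : IsComplete (e (PowerSeries.C r⁻¹)) H) (M K : ℕ)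
    {m : ℕ} (hm : m ≤ K) :
    (MvPolynomial.C (e PowerSeries.X) : MvPolynomial ℕ+ R) ^ M ∣
      (truncExp (C.comp (toSeries e)) M (vacuumExponent e u₀ r K)).coeff m -
        MvPolynomial.C (e (expSeries u₀)) *
          PowerSeries.coeff m (vertexSeries (e (expSeries (r / 2))) (e (expSeries (-(r / 2)))) H) := by
  cases M with
  | zero => simp
  | succ M =>
  set A := vacuumExponent e u₀ r K with hA
  set E := truncExp (C.comp (toSeries e)) (M + 1) A with hE
  set g := vertexSeries (e (expSeries (r / 2))) (e (expSeries (-(r / 2)))) H with hg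
  set z : MvPolynomial ℕ+ R := MvPolynomial.C (e PowerSeries.X) with hz
  have hzA : C z ∣ A := C_dvd_vacuumExponent e u₀ r K
  have hzA' : C z ∣ derivative A := by
    obtain ⟨B, hB⟩ := hzA
    rw [hB, derivative_C_mul]
    exact dvd_mul_right _ _
  have hode : C (z ^ (M + 1)) ∣ derivative E - derivative A * E := by
    rw [hE, derivative_truncExp, truncExp, truncExp, Finset.sum_range_succ, map_pow, pow_succ']
    convert! (mul_dvd_mul hzA' ((pow_dvd_pow_of_dvd hzA M).mul_left
      (C.comp (toSeries e) (MvPolynomial.C (1 / (M.factorial : ℂ)))))).neg_right using 1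
    ring
  have hφ : ∀ i : ℕ, MvPolynomial.C (e (modeFactor r (i + 1 : ℕ))) * ((i : MvPolynomial ℕ+ R) + 1) =
      MvPolynomial.C (e (PowerSeries.C r⁻¹)) * (MvPolynomial.C (e (expSeries (r / 2))) ^ (i + 1) -
        MvPolynomial.C (e (expSeries (-(r / 2)))) ^ (i + 1)) := by
    intro i
    rw [← map_pow, ← map_pow, ← map_pow, ← map_pow, ← map_sub, ← map_sub,
      ← C_mul_modeFactor_natCast, ← map_mul, ← map_mul, ← mul_assoc, ← map_mul,
      ← mul_assoc, inv_mul_cancel₀ hr, one_mul, map_mul e, map_mul MvPolynomial.C, mul_comm]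
    congr 1
    simp
  induction m using Nat.strong_induction_on with
  | _ m ih =>
    cases m with
    | zero =>
      rw [PowerSeries.coeff_zero_eq_constantCoeff_apply, hH.constantCoeff_vertexSeries, mul_one, hE,
        ← constantCoeff_apply, map_truncExp, constantCoeff_apply, hA,
        coeff_vacuumExponent e u₀ r (Nat.zero_le K)]
      have h0 : MvPolynomial.C (e (modeFactor r (0 : ℕ))) * toSeries e (vacuum u₀ (0 : ℕ)) =
          MvPolynomial.C (e (PowerSeries.X * PowerSeries.C u₀)) := by
        rw [Nat.cast_zero, modeFactor_zero, show vacuum u₀ 0 = MvPolynomial.C u₀ from rfl,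
          toSeries_C, map_mul e, map_mul MvPolynomial.C]
      have hcomp : constantCoeff.comp (C.comp (toSeries e)) = toSeries e :=
        RingHom.ext fun x => by simp
      rw [h0, hcomp]
      exact X_pow_dvd_truncExp_sub e u₀ (M + 1)
    | succ n =>
      have h1 := (C_dvd_iff_dvd_coeff _ _).1 hode n
      rw [coeff_sub, coeff_derivative, coeff_mul] at h1
      have h2 := congrArg (PowerSeries.coeff n) (hH.derivative_vertexSeries
        (e (expSeries (r / 2))) (e (expSeries (-(r / 2)))))
      rw [← hg, PowerSeries.coeff_derivative, PowerSeries.coeff_mul] at h2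
      have hu : IsUnit ((n : MvPolynomial ℕ+ R) + 1) := by
        have : ((n : ℂ) + 1) ≠ 0 := by exact_mod_cast Nat.succ_ne_zero n
        have := ((IsUnit.mk0 _ this).map (MvPolynomial.C (σ := ℕ+))).map (toSeries e)
        simpa using this
      rw [← hu.dvd_mul_right, sub_mul, mul_assoc, h2]
      have h3 : z ^ (M + 1) ∣ ∑ p ∈ Finset.HasAntidiagonal.antidiagonal n,
          (derivative A).coeff p.1 * (E.coeff p.2 -
            MvPolynomial.C (e (expSeries u₀)) * PowerSeries.coeff p.2 g) := by
        refine Finset.dvd_sum fun p hp => ?_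
        rw [Finset.HasAntidiagonal.mem_antidiagonal] at hp
        exact (ih p.2 (by omega) (by omega)).mul_left _
      have h4 : ∑ p ∈ Finset.HasAntidiagonal.antidiagonal n, (derivative A).coeff p.1 *
            (MvPolynomial.C (e (expSeries u₀)) * PowerSeries.coeff p.2 g) =
          MvPolynomial.C (e (expSeries u₀)) * ∑ p ∈ Finset.HasAntidiagonal.antidiagonal n,
            PowerSeries.coeff p.1 (PowerSeries.C (MvPolynomial.C (e (expSeries (r / 2)))) *
              PowerSeries.rescale (MvPolynomial.C (e (expSeries (r / 2))))
                (powerSumDeriv (e (PowerSeries.C r⁻¹))) -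
              PowerSeries.C (MvPolynomial.C (e (expSeries (-(r / 2))))) *
              PowerSeries.rescale (MvPolynomial.C (e (expSeries (-(r / 2)))))
                (powerSumDeriv (e (PowerSeries.C r⁻¹)))) * PowerSeries.coeff p.2 g := by
        rw [Finset.mul_sum]
        refine Finset.sum_congr rfl fun p hp => ?_
        rw [Finset.HasAntidiagonal.mem_antidiagonal] at hp
        rw [coeff_derivative, hA, coeff_vacuumExponent e u₀ r (show p.1 + 1 ≤ K by omega), map_sub,
          PowerSeries.coeff_C_mul, PowerSeries.coeff_C_mul, PowerSeries.coeff_rescale,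
          PowerSeries.coeff_rescale, powerSumDeriv, PowerSeries.coeff_mk,
          show vacuum u₀ ((p.1 + 1 : ℕ) : ℤ) = MvPolynomial.X p.1.succPNat from rfl, toSeries_X]
        have := hφ p.1
        linear_combination (MvPolynomial.X p.1.succPNat * MvPolynomial.C (e (expSeries u₀)) *
          PowerSeries.coeff p.2 g) * this
      simp only [mul_sub, Finset.sum_sub_distrib] at h3
      rw [h4] at h3
      convert! dvd_add h1 h3 using 1
      ring

end VacuumPart

/-! ### The integrated exponential as a vertex operator -/

section Bridge

open Polynomial

variable {R : Type*} [CommRing R] (e : PowerSeries ℂ ≃+* R)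

theorem pairing_eq_sum {A : Type*} [CommRing A] (g : ℕ → A) (p : A[X]) :
    pairing g p = ∑ k ∈ p.support, p.coeff k * g k := by
  conv_lhs => rw [p.as_sum_support, map_sum]
  simp only [pairing_monomial]

/-- The substitution `q_j ↦ q_j + ħ j c_{-j}`, where the modes outside `s` are left out. -/
noncomputable def modeShift (ħ r : ℂ) (s : Finset ℤ) : Fock →+* (MvPolynomial ℕ+ R)[X][X] :=
  MvPolynomial.eval₂Hom (((C.comp C).comp (toSeries e)).comp MvPolynomial.C)
    (fun j : ℕ+ => (C.comp C).comp (toSeries e) (MvPolynomial.X j) +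
      (C.comp C).comp (toSeries e) (MvPolynomial.C (ħ * j)) *
      (if -(j : ℤ) ∈ s then modeCoeff e r (-(j : ℤ)) else 0))

theorem modeShift_C (ħ r : ℂ) (s : Finset ℤ) (x : ℂ) : modeShift e ħ r s (MvPolynomial.C x) =
    (C.comp C).comp (toSeries e) (MvPolynomial.C x) :=
  MvPolynomial.eval₂Hom_C _ _ _

theorem modeShift_X (ħ r : ℂ) (s : Finset ℤ) (j : ℕ+) : modeShift e ħ r s (MvPolynomial.X j) =
    (C.comp C).comp (toSeries e) (MvPolynomial.X j) +
      (C.comp C).comp (toSeries e) (MvPolynomial.C (ħ * j)) *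
      (if -(j : ℤ) ∈ s then modeCoeff e r (-(j : ℤ)) else 0) :=
  MvPolynomial.eval₂Hom_X' _ _ _

theorem C_dvd_modeCoeff (r : ℂ) (k : ℤ) :
    C (C (MvPolynomial.C (e PowerSeries.X))) ∣ modeCoeff e r k := by
  rw [modeCoeff, ← C_mul_X_pow_eq_monomial, ← C_mul_X_pow_eq_monomial, C_mul]
  exact ((_root_.map_dvd C (_root_.map_dvd C (_root_.map_dvd MvPolynomial.C
    (_root_.map_dvd e (X_dvd_modeFactor r k))))).mul_right _).mul_right _

/-- If `s` contains the modes of all variables of `f`, the substitution is the shift of `f`, since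
`ħ j φ_j = r (a^j - b^j)`. -/
theorem modeShift_eq_shift {ħ r : ℂ} (hħ : r ^ 2 = ħ) {f : Fock} {K : ℕ}
    (hK : ∀ j ∈ f.vars, (j : ℕ) ≤ K) :
    modeShift e ħ r (Finset.Icc (-(K : ℤ)) K) f = (shift (e (PowerSeries.C r)) (e (expSeries (r / 2)))
      (e (expSeries (-(r / 2)))) (toSeries e f)).map C := by
  set a := e (expSeries (r / 2)) with ha
  set b := e (expSeries (-(r / 2))) with hb
  set σ : MvPolynomial ℕ+ R →+* (MvPolynomial ℕ+ R)[X] :=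
    (shift (e (PowerSeries.C r)) a b : MvPolynomial ℕ+ R →+* (MvPolynomial ℕ+ R)[X]) with hσ
  have hmap : ∀ g, ((Polynomial.mapRingHom C).comp (σ.comp (toSeries e))) g =
      (shift (e (PowerSeries.C r)) a b (toSeries e g)).map C := fun g => rfl
  rw [← hmap]
  refine MvPolynomial.hom_congr_vars (R := ℂ) (σ := ℕ+) (S := (MvPolynomial ℕ+ R)[X][X])
    (f₁ := modeShift e ħ r (Finset.Icc (-(K : ℤ)) K))
    (f₂ := (Polynomial.mapRingHom C).comp (σ.comp (toSeries e))) ?_ (fun j hj _ => ?_) rfl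
  · refine RingHom.ext fun x => ?_
    rw [RingHom.comp_apply, RingHom.comp_apply, hmap, toSeries_C, shift_C, Polynomial.map_C,
      modeShift_C, RingHom.comp_apply, toSeries_C, RingHom.comp_apply]
  · have hmem : -(j : ℤ) ∈ Finset.Icc (-(K : ℤ)) K := by
      have := hK j hj
      rw [Finset.mem_Icc]
      omega
    have hmode : e (PowerSeries.C (ħ * j)) * e (modeFactor r j) =
        e (PowerSeries.C r) * (a ^ (j : ℕ) - b ^ (j : ℕ)) := by
      have h := C_mul_modeFactor_natCast r j
      rw [ha, hb, ← map_pow, ← map_pow, ← map_sub, ← map_mul, ← map_mul, ← h, ← mul_assoc,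
        ← map_mul, ← hħ, show r ^ 2 * ((j : ℕ) : ℂ) = r * (r * (j : ℕ)) by ring]
    rw [hmap, toSeries_X, modeShift_X, if_pos hmem]
    simp only [RingHom.comp_apply, toSeries_X, toSeries_C]
    rw [shift, MvPolynomial.aeval_X, ← hmode, Polynomial.map_add,
      Polynomial.map_mul, Polynomial.map_pow, Polynomial.map_X, Polynomial.map_C,
      Polynomial.map_C, modeCoeff, modeFactor_neg, neg_neg, Int.toNat_natCast,
      show (-(j : ℤ)).toNat = 0 by omega, monomial_zero_left, ← C_mul_X_pow_eq_monomial,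
      map_mul MvPolynomial.C, C_mul, C_mul]
    ring

theorem dvd_constTerm_sub {A : Type*} [CommRing A] {w : A} {x : A[X][X]} {p d : A[X]}
    (h : C (C w) ∣ x - C p * d.map C) : w ∣ constTerm x - pairing p.coeff d := by
  obtain ⟨q, hq⟩ := h
  have := congrArg constTerm hq
  rw [map_sub, constTerm_C_C_mul, constTerm_C_mul_map] at this
  exact ⟨_, this⟩

theorem truncExp_sum_modeCoeff (u₀ r : ℂ) (M K : ℕ) :
    truncExp ((C.comp C).comp (toSeries e)) M (∑ k ∈ Finset.Icc (-(K : ℤ)) K,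
      modeCoeff e r k * ((C.comp C).comp (toSeries e)) (vacuum u₀ k)) =
    C (truncExp (C.comp (toSeries e)) M (vacuumExponent e u₀ r K)) := by
  rw [sum_modeCoeff_mul_vacuum]
  simp only [truncExp, map_sum, map_mul, map_pow, RingHom.comp_apply]

theorem pow_dvd_normalOrderExp_modeCoeff_sub (u₀ : ℂ) {ħ r : ℂ} (hħ : r ^ 2 = ħ) (f : Fock) (M : ℕ)
    {K : ℕ} (hK : ∀ j ∈ f.vars, (j : ℕ) ≤ K) :
    C (C ((MvPolynomial.C (e PowerSeries.X) : MvPolynomial ℕ+ R) ^ M)) ∣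
      normalOrderExp u₀ ħ ((C.comp C).comp (toSeries e)) M (Finset.Icc (-(K : ℤ)) K)
        (modeCoeff e r) f -
      C (truncExp (C.comp (toSeries e)) M (vacuumExponent e u₀ r K)) *
        (shift (e (PowerSeries.C r)) (e (expSeries (r / 2))) (e (expSeries (-(r / 2))))
          (toSeries e f)).map C := by
  rw [← truncExp_sum_modeCoeff, ← modeShift_eq_shift e hħ hK, map_pow, map_pow]
  exact pow_dvd_normalOrderExp_sub u₀ ħ ((C.comp C).comp (toSeries e)) M _ (modeCoeff e r)
    (C_dvd_modeCoeff e r) (modeShift e ħ r (Finset.Icc (-(K : ℤ)) K)) (modeShift_C e ħ r _) (modeShift_X e ħ r _) f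

/-- Once all modes that act on `f` are included, the constant term of the truncated exponential is
`e^{z u₀}` times the vertex operator, modulo `z^M`. -/
theorem pow_dvd_constTerm_sub (u₀ : ℂ) {ħ r : ℂ} (hr : r ≠ 0) (hħ : r ^ 2 = ħ)
    {H : PowerSeries (MvPolynomial ℕ+ R)} (hH : IsComplete (e (PowerSeries.C r⁻¹)) H)
    (f : Fock) (M : ℕ) :
    ∀ᶠ K : ℕ in Filter.atTop, (MvPolynomial.C (e PowerSeries.X) : MvPolynomial ℕ+ R) ^ M ∣
      constTerm (normalOrderExp u₀ ħ ((C.comp C).comp (toSeries e)) M (Finset.Icc (-(K : ℤ)) K)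
        (modeCoeff e r) f) -
      MvPolynomial.C (e (expSeries u₀)) * vertexOp (e (PowerSeries.C r)) (e (expSeries (r / 2)))
        (e (expSeries (-(r / 2)))) H (toSeries e f) := by
  set a := e (expSeries (r / 2)) with ha
  set b := e (expSeries (-(r / 2))) with hb
  have hvars : ∀ᶠ K : ℕ in Filter.atTop, ∀ j ∈ f.vars, (j : ℕ) ≤ K := by
    rw [Filter.eventually_all_finset]
    intro j _
    exact Filter.eventually_ge_atTop _
  set D := shift (e (PowerSeries.C r)) a b (toSeries e f) with hD
  filter_upwards [hvars, Filter.eventually_ge_atTop D.natDegree] with K hK hdeg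
  set z : MvPolynomial ℕ+ R := MvPolynomial.C (e PowerSeries.X) with hz
  have h2 := dvd_constTerm_sub (pow_dvd_normalOrderExp_modeCoeff_sub e u₀ hħ f M hK)
  have h3 : z ^ M ∣ pairing (truncExp (C.comp (toSeries e)) M (vacuumExponent e u₀ r K)).coeff D -
      MvPolynomial.C (e (expSeries u₀)) * vertexOp (e (PowerSeries.C r)) a b H (toSeries e f) := by
    rw [vertexOp, ← hD, pairing_eq_sum, pairing_eq_sum, Finset.mul_sum, ← Finset.sum_sub_distrib]
    refine Finset.dvd_sum fun k hk => ?_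
    have hk' : k ≤ K := (le_natDegree_of_mem_supp k hk).trans hdeg
    have := (pow_dvd_coeff_truncExp_sub e u₀ hr hH M K hk').mul_left (D.coeff k)
    convert! this using 1
    ring
  convert! dvd_add h2 h3 using 1
  ring

/-- The exponential series, integrated over the circle, is `e^{z u₀}` times the vertex operator. -/
theorem coeff_expIntegral_eq_vertexOp (u₀ : ℂ) {ħ r : ℂ} (hr : r ≠ 0) (hħ : r ^ 2 = ħ)
    {H : PowerSeries (MvPolynomial ℕ+ R)} (hH : IsComplete (e (PowerSeries.C r⁻¹)) H)
    (f : Fock) (m : ℕ) (d : ℕ+ →₀ ℕ) :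
    MvPolynomial.coeff d (PowerSeries.coeff m (expIntegral u₀ ħ r) f) =
      PowerSeries.coeff m (e.symm (MvPolynomial.coeff d (MvPolynomial.C (e (expSeries u₀)) *
        vertexOp (e (PowerSeries.C r)) (e (expSeries (r / 2))) (e (expSeries (-(r / 2)))) H
          (toSeries e f)))) := by
  obtain ⟨K, hK1, hK2⟩ := ((coeff_expIntegral_apply e u₀ ħ r f m d).and
    (pow_dvd_constTerm_sub e u₀ hr hħ hH f (m + 1))).exists
  rw [hK1, ← sub_eq_zero, ← map_sub, ← map_sub, ← MvPolynomial.coeff_sub]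
  rw [← map_pow, ← map_pow, MvPolynomial.C_dvd_iff_dvd_coeff] at hK2
  have h := map_dvd e.symm (hK2 d)
  rw [RingEquiv.symm_apply_apply] at h
  exact PowerSeries.X_pow_dvd_iff.1 h m (Nat.lt_succ_self m)

end Bridge

/-! ### Schur polynomials as eigenvectors -/

section Schur

open PowerSeries

/-- The generating series `∑ h_k(q) t^k`. -/
noncomputable def completeSeries : PowerSeries Fock := (PowerSeries.exp ℂ).subst powerSumSeries

theorem completeSeries_eq : completeSeries = (PowerSeries.exp Fock).subst powerSumSeries := by
  ext1 n
  rw [completeSeries, coeff_subst' hasSubst_powerSumSeries, coeff_subst' hasSubst_powerSumSeries]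
  refine finsum_congr fun d => ?_
  rw [coeff_exp, coeff_exp, Algebra.smul_def, smul_eq_mul]
  congr 1

theorem constantCoeff_powerSumSeries : constantCoeff powerSumSeries = 0 := by
  rw [← coeff_zero_eq_constantCoeff_apply, powerSumSeries, coeff_mk]
  simp

theorem isComplete_completeSeries : IsComplete 1 completeSeries where
  constantCoeff_eq := by
    rw [completeSeries_eq, ← coeff_zero_eq_constantCoeff_apply,
      coeff_subst' hasSubst_powerSumSeries, finsum_eq_single _ 0]
    · simp
    · intro n hn
      rw [coeff_zero_eq_constantCoeff_apply, map_pow, constantCoeff_powerSumSeries, zero_pow hn,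
        smul_zero]
  derivative_eq := by
    rw [completeSeries_eq, PowerSeries.derivative_subst hasSubst_powerSumSeries, derivative_exp,
      mul_comm]
    congr 1
    ext1 n
    have h3 : coeff (n + 1) powerSumSeries =
        MvPolynomial.C (1 / ((n + 1 : ℕ) : ℂ)) * MvPolynomial.X n.succPNat := by
      rw [powerSumSeries, coeff_mk, dif_pos (Nat.succ_pos n)]
      rfl
    rw [coeff_derivative, h3, powerSumDeriv, coeff_mk]
    have h : ((n : ℂ) + 1) ≠ 0 := by exact_mod_cast Nat.succ_ne_zero n
    have h2 : MvPolynomial.C (1 / ((n + 1 : ℕ) : ℂ)) * ((n : Fock) + 1) = 1 := by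
      rw [← map_natCast (MvPolynomial.C (σ := ℕ+) (R := ℂ)), ← map_one MvPolynomial.C, ← map_add,
        ← map_mul]
      congr 1
      push_cast
      field_simp
    rw [map_one, one_mul, mul_right_comm, h2, one_mul]

variable {R : Type*} [CommRing R] (e : PowerSeries ℂ ≃+* R)

/-- The generating series `∑ h_k(q / r) t^k` over `ℂ⟦z⟧`. -/
noncomputable def scaledCompleteSeries (r : ℂ) : PowerSeries (MvPolynomial ℕ+ R) :=
  map ((toSeries e).comp (MvPolynomial.aeval (R := ℂ) fun k : ℕ+ =>
    MvPolynomial.C r⁻¹ * (MvPolynomial.X k : Fock)).toRingHom) completeSeries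

theorem isComplete_scaledCompleteSeries (r : ℂ) :
    IsComplete (e (PowerSeries.C r⁻¹)) (scaledCompleteSeries e r) where
  constantCoeff_eq := by
    rw [scaledCompleteSeries, ← coeff_zero_eq_constantCoeff_apply, coeff_map,
      coeff_zero_eq_constantCoeff_apply, isComplete_completeSeries.constantCoeff_eq, map_one]
  derivative_eq := by
    rw [scaledCompleteSeries, derivative_map, isComplete_completeSeries.derivative_eq, map_mul]
    congr 1
    ext1 n
    rw [coeff_map, powerSumDeriv, powerSumDeriv, coeff_mk, coeff_mk, map_one, one_mul,
      RingHom.comp_apply, AlgHom.toRingHom_eq_coe, RingHom.coe_coe, MvPolynomial.aeval_X, map_mul,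
      toSeries_C, toSeries_X]

theorem toSeries_schurScaled (r : ℂ) (lam : YoungDiagram) :
    toSeries e (schurScaled r lam) =
      jacobiTrudi (scaledCompleteSeries e r) fun i : Fin (numRows lam) => lam.rowLen i := by
  rw [schurScaled, schur, AlgHom.map_det, RingHom.map_det, jacobiTrudi]
  congr 1
  ext1 i j
  simp only [RingHom.mapMatrix_apply, AlgHom.mapMatrix_apply, Matrix.map_apply, Matrix.of_apply,
    hPoly, intCoeff]
  split_ifs
  · rw [scaledCompleteSeries, coeff_map]
    rfl
  · rw [map_zero, map_zero]

theorem map_vertexEigenvalue (a b : PowerSeries ℂ) {l : ℕ} (μ : Fin l → ℕ) :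
    vertexEigenvalue (e a) (e b) μ = e (vertexEigenvalue a b μ) := by
  simp only [vertexEigenvalue, map_add, map_mul, map_pow, map_sub, map_one, map_sum]

theorem coeff_expIntegral_schurScaled [IsDomain R] [CharZero R] (e : PowerSeries ℂ ≃+* R) (u₀ : ℂ) {ħ r : ℂ} (hr : r ≠ 0) (hħ : r ^ 2 = ħ)
    (lam : YoungDiagram) (m : ℕ) (d : ℕ+ →₀ ℕ) :
    MvPolynomial.coeff d (PowerSeries.coeff m (expIntegral u₀ ħ r) (schurScaled r lam)) =
      PowerSeries.coeff m (expSeries u₀ * vertexEigenvalue (expSeries (r / 2))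
        (expSeries (-(r / 2))) fun i : Fin (numRows lam) => lam.rowLen i) *
        MvPolynomial.coeff d (schurScaled r lam) := by
  have hab : e (expSeries (r / 2)) * e (expSeries (-(r / 2))) = 1 := by
    rw [← map_mul, expSeries_mul, add_neg_cancel, expSeries_zero, map_one]
  have hrr : e (PowerSeries.C r) * e (PowerSeries.C r⁻¹) = 1 := by
    rw [← map_mul, ← map_mul, mul_inv_cancel₀ hr, map_one, map_one]
  have hH := isComplete_scaledCompleteSeries e r
  rw [coeff_expIntegral_eq_vertexOp e u₀ hr hħ hH, toSeries_schurScaled,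
    hH.vertexOp_jacobiTrudi hrr hab, map_vertexEigenvalue, ← mul_assoc, ← map_mul, ← map_mul,
    MvPolynomial.coeff_C_mul, ← toSeries_schurScaled, toSeries, MvPolynomial.coeff_map,
    RingHom.comp_apply, RingEquiv.coe_toRingHom, ← map_mul, RingEquiv.symm_apply_apply,
    PowerSeries.coeff_mul_C]

theorem expIntegral_schurScaled (u₀ : ℂ) {ħ r : ℂ} (hr : r ≠ 0) (hħ : r ^ 2 = ħ)
    (lam : YoungDiagram) (m : ℕ) :
    PowerSeries.coeff m (expIntegral u₀ ħ r) (schurScaled r lam) =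
      PowerSeries.coeff m (expSeries u₀ * vertexEigenvalue (expSeries (r / 2))
        (expSeries (-(r / 2))) fun i : Fin (numRows lam) => lam.rowLen i) • schurScaled r lam := by
  ext d
  rw [MvPolynomial.coeff_smul, smul_eq_mul]
  have : CharZero (PowerSeries ℂ) := charZero_of_injective_ringHom (PowerSeries.C_injective (R := ℂ))
  exact coeff_expIntegral_schurScaled (RingEquiv.refl _) u₀ hr hħ lam m d

end Schur

/-! ### Nonvanishing of Schur polynomials, and contents -/

section Nonvanishing

open PowerSeries

/-- At `q₁ = 1` and `q_k = 0` for `k ≥ 2` the complete symmetric functions are `h_n = 1 / n!`. -/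
theorem eval_coeff_completeSeries (n : ℕ) :
    MvPolynomial.eval (fun k : ℕ+ => if k = 1 then (1 : ℂ) else 0) (coeff n completeSeries) =
      1 / (n.factorial : ℂ) := by
  set φ := MvPolynomial.eval (fun k : ℕ+ => if k = 1 then (1 : ℂ) else 0) with hφ
  have hP : map φ (powerSumDeriv 1) = 1 := by
    ext1 m
    rw [coeff_map, powerSumDeriv, coeff_mk, map_one, one_mul, hφ, MvPolynomial.eval_X, coeff_one]
    congr 1
    rw [← PNat.coe_inj]
    simp
  have h : map φ completeSeries = PowerSeries.exp ℂ := by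
    refine exp_unique_of_derivative_eq_self ?_ ?_
    · rw [derivative_map, isComplete_completeSeries.derivative_eq, map_mul, hP, one_mul]
    · rw [← coeff_zero_eq_constantCoeff_apply, coeff_map, coeff_zero_eq_constantCoeff_apply,
        isComplete_completeSeries.constantCoeff_eq, map_one]
  rw [← coeff_map, h, coeff_exp]
  simp

/-- The specialization `q₁ = 1`, `q_k = 0` for `k ≥ 2` of a Schur polynomial does not vanish: the
determinant is, up to nonzero factors, the Vandermonde determinant of the numbers `λ_i + l - i`. -/
theorem schurScaled_ne_zero {r : ℂ} (hr : r ≠ 0) (lam : YoungDiagram) : schurScaled r lam ≠ 0 := by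
  set l := numRows lam with hl
  set L : Fin l → ℕ := fun i => lam.rowLen i + (Fin.rev i : ℕ) with hL
  have hLinj : Function.Injective L := by
    refine StrictAnti.injective fun i j hij => ?_
    have h1 := lam.rowLen_anti i j (Fin.le_def.1 hij.le)
    have h2 : (Fin.rev j : ℕ) < (Fin.rev i : ℕ) := Fin.lt_def.1 (Fin.rev_lt_rev.2 hij)
    simp only [hL]
    omega
  intro h0
  have h1 := congrArg (MvPolynomial.eval (fun k : ℕ+ => if k = 1 then r else 0)) h0
  have hcomp : ∀ f : Fock, MvPolynomial.eval (fun k : ℕ+ => if k = 1 then r else 0)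
      (MvPolynomial.aeval (fun k : ℕ+ => MvPolynomial.C r⁻¹ * (MvPolynomial.X k : Fock)) f) =
        MvPolynomial.eval (fun k : ℕ+ => if k = 1 then (1 : ℂ) else 0) f := by
    intro f
    induction f using MvPolynomial.induction_on with
    | C x => simp
    | add p q hp hq => simp only [map_add, hp, hq]
    | mul_X p k hp =>
      rw [map_mul, map_mul, hp, map_mul, MvPolynomial.aeval_X, map_mul, MvPolynomial.eval_C,
        MvPolynomial.eval_X, MvPolynomial.eval_X]
      split_ifs <;> simp [hr]
  rw [schurScaled, hcomp, map_zero, schur, RingHom.map_det] at h1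
  have hentry : (MvPolynomial.eval (fun k : ℕ+ => if k = 1 then (1 : ℂ) else 0)).mapMatrix
      (Matrix.of fun i j : Fin l =>
        hPoly ((lam.rowLen i : ℤ) - ((i : ℕ) : ℤ) + ((j : ℕ) : ℤ))) =
      Matrix.of fun i j : Fin l => (1 / ((L i).factorial : ℂ)) *
        ((Matrix.of fun i j : Fin l => (descPochhammer ℂ (j : ℕ)).eval (L i : ℂ)).submatrix id
          Fin.revPerm) i j := by
    ext1 i j
    simp only [RingHom.mapMatrix_apply, Matrix.map_apply, Matrix.of_apply, Matrix.submatrix_apply,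
      id, Fin.revPerm_apply]
    rw [descPochhammer_eval_eq_descFactorial ℂ]
    have hrev : ∀ i : Fin l, ((Fin.rev i : ℕ) : ℤ) = l - 1 - (i : ℕ) := by
      intro i
      rw [Fin.val_rev]
      omega
    have hidx : (lam.rowLen i : ℤ) - ((i : ℕ) : ℤ) + ((j : ℕ) : ℤ) = (L i : ℤ) - (Fin.rev j : ℕ) := by
      simp only [hL]
      push_cast
      rw [hrev, hrev]
      ring
    rw [hidx]
    rcases le_or_gt (Fin.rev j : ℕ) (L i) with hle | hlt
    · rw [← Nat.cast_sub hle, hPoly, if_pos (by positivity), Int.toNat_natCast]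
      rw [show ((PowerSeries.exp ℂ).subst powerSumSeries : PowerSeries Fock) = completeSeries from rfl,
        eval_coeff_completeSeries]
      have h2 := Nat.factorial_mul_descFactorial hle
      have h3 : ((L i - (Fin.rev j : ℕ)).factorial : ℂ) ≠ 0 := by
        exact_mod_cast Nat.factorial_ne_zero _
      have h4 : ((L i).factorial : ℂ) ≠ 0 := by exact_mod_cast Nat.factorial_ne_zero _
      have h5 : ((L i - (Fin.rev j : ℕ)).factorial : ℂ) * ((L i).descFactorial (Fin.rev j : ℕ) : ℂ) =
          ((L i).factorial : ℂ) := by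
        exact_mod_cast h2
      rw [one_div_mul_eq_div, div_eq_div_iff h3 h4, one_mul, mul_comm, h5]
    · rw [Nat.descFactorial_of_lt hlt, hPoly, if_neg (by omega)]
      simp
  rw [hentry, Matrix.det_mul_column, Matrix.det_permute',
    ← Matrix.det_eval_matrixOfPolynomials_eq_det_vandermonde (fun i => (L i : ℂ))
      (fun j => descPochhammer ℂ j) (fun j => descPochhammer_natDegree ℂ j)
      (fun j => monic_descPochhammer ℂ j)] at h1
  have hV : (Matrix.vandermonde fun i => (L i : ℂ)).det ≠ 0 :=
    Matrix.det_vandermonde_ne_zero_iff.2 (Nat.cast_injective.comp hLinj)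
  refine mul_ne_zero ?_ (mul_ne_zero ?_ hV) h1
  · exact Finset.prod_ne_zero_iff.2 fun i _ =>
      one_div_ne_zero (by exact_mod_cast Nat.factorial_ne_zero _)
  · rcases Int.units_eq_one_or (Equiv.Perm.sign (Fin.revPerm : Equiv.Perm (Fin l))) with h | h <;>
      simp [h]

end Nonvanishing

section Contents

/-- `i` is smaller than the length of the diagonal if and only if the cell `(i, i)` belongs to the
diagram. -/
theorem lt_diagLength_iff (lam : YoungDiagram) (i : ℕ) : i < diagLength lam ↔ (i, i) ∈ lam := by
  have hex : ∃ n, (n, n) ∉ lam := by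
    obtain ⟨j, hj⟩ := lam.exists_notMem_row 0
    exact ⟨j, fun h => hj (lam.up_left_mem (Nat.zero_le j) le_rfl h)⟩
  classical
  have hiff : ∀ i, i < Nat.find hex ↔ (i, i) ∈ lam := by
    intro i
    refine ⟨fun h => not_not.1 (Nat.find_min hex h), fun h => ?_⟩
    by_contra hle
    exact Nat.find_spec hex (lam.up_left_mem (not_lt.1 hle) (not_lt.1 hle) h)
  have hcard : diagLength lam = Nat.find hex := by
    rw [diagLength, ← Finset.card_range (Nat.find hex),
      ← Finset.card_image_of_injective (Finset.range (Nat.find hex))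
        (fun a b h => (Prod.mk.inj h).1 : Function.Injective fun i : ℕ => (i, i))]
    congr 1
    ext ⟨a, b⟩
    simp only [Finset.mem_filter, YoungDiagram.mem_cells, Finset.mem_image, Finset.mem_range,
      Prod.mk.injEq]
    constructor
    · rintro ⟨h, rfl⟩
      exact ⟨a, (hiff a).2 h, rfl, rfl⟩
    · rintro ⟨c, hc, rfl, rfl⟩
      exact ⟨(hiff c).1 hc, rfl⟩
  rw [hcard, hiff]

/-- Both sides are the sum of `f(c) - f(c - 1)` over the contents `c` of the cells, which is taken
along the rows on the left and along the hooks with corner on the diagonal on the right. -/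
theorem sum_rows_eq_sum_frobenius (lam : YoungDiagram) (f : ℤ → ℂ) :
    ∑ i ∈ Finset.range (numRows lam), (f ((lam.rowLen i : ℤ) - (i + 1)) - f (-((i : ℤ) + 1))) =
      ∑ i ∈ Finset.range (diagLength lam), (f (frobAlpha lam i) - f (-(frobBeta lam i + 1))) := by
  have htel : ∀ (g : ℕ → ℂ) (m n : ℕ), m ≤ n →
      ∑ j ∈ Finset.Ico m n, (g (j + 1) - g j) = g n - g m := fun g m n h =>
    Finset.sum_Ico_sub g h
  have hrows : ∑ c ∈ lam.cells, (f ((c.2 : ℤ) - c.1) - f ((c.2 : ℤ) - c.1 - 1)) =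
      ∑ i ∈ Finset.range (numRows lam),
        (f ((lam.rowLen i : ℤ) - (i + 1)) - f (-((i : ℤ) + 1))) := by
    rw [Finset.sum_finset_product lam.cells (Finset.range (numRows lam))
      (fun i => Finset.range (lam.rowLen i))]
    · refine Finset.sum_congr rfl fun i _ => ?_
      have := htel (fun j => f ((j : ℤ) - (i + 1))) 0 (lam.rowLen i) (Nat.zero_le _)
      rw [Finset.range_eq_Ico]
      rw [Nat.cast_zero, zero_sub] at this
      rw [← this]
      refine Finset.sum_congr rfl fun j _ => ?_
      congr 2 <;> push_cast <;> ring
    · rintro ⟨i, j⟩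
      simp only [YoungDiagram.mem_cells, Finset.mem_range]
      rw [numRows, ← YoungDiagram.mem_iff_lt_colLen, ← YoungDiagram.mem_iff_lt_rowLen]
      exact ⟨fun h => ⟨lam.up_left_mem le_rfl (Nat.zero_le j) h, h⟩, fun h => h.2⟩
  have hdiag : ∀ i ∈ Finset.range (diagLength lam), i < lam.rowLen i ∧ i < lam.colLen i := by
    intro i hi
    rw [Finset.mem_range, lt_diagLength_iff] at hi
    exact ⟨YoungDiagram.mem_iff_lt_rowLen.1 hi, YoungDiagram.mem_iff_lt_colLen.1 hi⟩
  have hupper : ∑ c ∈ lam.cells.filter (fun c => c.1 ≤ c.2),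
      (f ((c.2 : ℤ) - c.1) - f ((c.2 : ℤ) - c.1 - 1)) =
      ∑ i ∈ Finset.range (diagLength lam), (f (frobAlpha lam i) - f (-1)) := by
    rw [Finset.sum_finset_product _ (Finset.range (diagLength lam))
      (fun i => Finset.Ico i (lam.rowLen i))]
    · refine Finset.sum_congr rfl fun i hi => ?_
      have := htel (fun j => f ((j : ℤ) - (i + 1))) i (lam.rowLen i) (hdiag i hi).1.le
      rw [show (i : ℤ) - (i + 1) = -1 by ring] at this
      rw [frobAlpha, ← this]
      refine Finset.sum_congr rfl fun j _ => ?_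
      congr 2 <;> push_cast <;> ring
    · rintro ⟨i, j⟩
      simp only [Finset.mem_filter, YoungDiagram.mem_cells, Finset.mem_range, Finset.mem_Ico]
      rw [lt_diagLength_iff, ← YoungDiagram.mem_iff_lt_rowLen]
      exact ⟨fun h => ⟨lam.up_left_mem le_rfl h.2 h.1, h.2, h.1⟩, fun h => ⟨h.2.2, h.2.1⟩⟩
  have hlower : ∑ c ∈ lam.cells.filter (fun c => ¬ c.1 ≤ c.2),
      (f ((c.2 : ℤ) - c.1) - f ((c.2 : ℤ) - c.1 - 1)) =
      ∑ i ∈ Finset.range (diagLength lam), (f (-1) - f (-(frobBeta lam i + 1))) := by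
    rw [Finset.sum_finset_product_right _ (Finset.range (diagLength lam))
      (fun j => Finset.Ico (j + 1) (lam.colLen j))]
    · refine Finset.sum_congr rfl fun j hj => ?_
      have := htel (fun i => -f ((j : ℤ) - i)) (j + 1) (lam.colLen j) (hdiag j hj).2
      rw [frobBeta, YoungDiagram.rowLen_transpose,
        show -((lam.colLen j : ℤ) - (j + 1) + 1) = (j : ℤ) - lam.colLen j by ring]
      rw [show (j : ℤ) - ((j + 1 : ℕ) : ℤ) = -1 by push_cast; ring] at this
      rw [show f (-1) - f ((j : ℤ) - lam.colLen j) = -f ((j : ℤ) - lam.colLen j) - -f (-1) by ring,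
        ← this]
      refine Finset.sum_congr rfl fun i _ => ?_
      rw [show (j : ℤ) - ((i + 1 : ℕ) : ℤ) = (j : ℤ) - i - 1 by push_cast; ring]
      ring
    · rintro ⟨i, j⟩
      simp only [Finset.mem_filter, YoungDiagram.mem_cells, Finset.mem_range, Finset.mem_Ico, not_le]
      rw [lt_diagLength_iff, ← YoungDiagram.mem_iff_lt_colLen]
      exact ⟨fun h => ⟨lam.up_left_mem h.2.le le_rfl h.1, h.2, h.1⟩, fun h => ⟨h.2.2, h.2.1⟩⟩
  rw [← hrows, ← Finset.sum_filter_add_sum_filter_not lam.cells (fun c => c.1 ≤ c.2), hupper, hlower,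
    ← Finset.sum_add_distrib]
  exact Finset.sum_congr rfl fun i _ => by ring

theorem eigenvalueRows_eq_eigenvalueFrobenius (u₀ r : ℂ) (lam : YoungDiagram) (k : ℤ) :
    eigenvalueRows u₀ r lam k = eigenvalueFrobenius u₀ r lam k := by
  have h := sum_rows_eq_sum_frobenius lam
    (fun x => (u₀ + r * ((x : ℂ) + 1 / 2)) ^ (k + 1).toNat / (Nat.factorial (k + 1).toNat : ℂ))
  rw [eigenvalueRows, eigenvalueFrobenius]
  congr 2
  simp only [← sub_div] at h
  convert! h using 4
  · push_cast; ring
  · push_cast; ring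
  · push_cast; ring

end Contents

/-! ### The eigenvalues -/

section Scalars

open PowerSeries

/-- The series of `t / (e^{t/2} - e^{-t/2})`. -/
noncomputable def sInvSeries : PowerSeries ℂ :=
  mk fun j => -((1 - (2 : ℂ) ^ (1 - (j : ℤ))) * ((bernoulli j : ℚ) : ℂ) / (j.factorial : ℂ))

/-- With `B(t) = t / (e^t - 1)` the series of `t / (e^{t/2} - e^{-t/2})` is `2 B(t/2) - B(t)`. -/
theorem sInvSeries_eq :
    sInvSeries = C 2 * rescale (1 / 2 : ℂ) (bernoulliPowerSeries ℂ) - bernoulliPowerSeries ℂ := by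
  ext n
  rw [sInvSeries, coeff_mk, map_sub, coeff_C_mul, coeff_rescale, bernoulliPowerSeries, coeff_mk,
    zpow_sub₀ two_ne_zero, zpow_one, zpow_natCast]
  simp only [eq_ratCast, Rat.cast_div, Rat.cast_natCast]
  rw [one_div, inv_pow]
  ring

theorem sInvSeries_mul_sSeries : sInvSeries * sSeries = 1 := by
  have hB := bernoulliPowerSeries_mul_exp_sub_one ℂ
  have hB2 := congrArg (rescale (1 / 2 : ℂ)) hB
  rw [map_mul, map_sub, map_one, rescale_X] at hB2
  have hs := X_mul_sSeries
  have hp : rescale (1 / 2 : ℂ) (PowerSeries.exp ℂ) * rescale (1 / 2 : ℂ) (PowerSeries.exp ℂ) =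
      PowerSeries.exp ℂ := by
    rw [exp_mul_exp_eq_exp_add]
    norm_num
  have hpm : rescale (1 / 2 : ℂ) (PowerSeries.exp ℂ) * rescale (-1 / 2 : ℂ) (PowerSeries.exp ℂ) =
      1 := by
    rw [exp_mul_exp_eq_exp_add]
    norm_num [rescale_zero]
  have h2 : (C (2 : ℂ) * C (1 / 2) : PowerSeries ℂ) = 1 := by
    rw [← map_mul]
    norm_num
  refine mul_left_cancel₀ (X_ne_zero (R := ℂ)) ?_
  rw [sInvSeries_eq]
  set p := rescale (1 / 2 : ℂ) (PowerSeries.exp ℂ)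
  set m := rescale (-1 / 2 : ℂ) (PowerSeries.exp ℂ)
  set B := bernoulliPowerSeries ℂ
  set B2 := rescale (1 / 2 : ℂ) (bernoulliPowerSeries ℂ)
  rw [← hp] at hB
  linear_combination (C 2 * B2 - B) * hs + (C 2 * m * (p + 1)) * hB2 - m * hB +
    (m * (p + 1) * X) * h2 + (X - C 2 * B2 * p + B * p) * hpm

theorem rescale_sSeries_inv (r : ℂ) : (rescale r sSeries)⁻¹ = rescale r sInvSeries := by
  rw [PowerSeries.inv_eq_iff_mul_eq_one]
  · rw [← map_mul, sInvSeries_mul_sSeries, map_one]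
  · rw [← coeff_zero_eq_constantCoeff_apply, coeff_rescale, coeff_zero_eq_constantCoeff_apply,
      constantCoeff_sSeries]
    simp

theorem coeff_rescale_sInvSeries_mul (u₀ r : ℂ) (k : ℤ) :
    coeff (k + 2).toNat (rescale r sInvSeries * expSeries u₀) = vacuumEigenvalue u₀ r k := by
  rw [vacuumEigenvalue, coeff_mul, Finset.Nat.sum_antidiagonal_eq_sum_range_succ_mk, Finset.mul_sum]
  refine Finset.sum_congr rfl fun j hj => ?_
  have hj' : j ≤ (k + 2).toNat := by
    rw [Finset.mem_range] at hj
    omega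
  rw [coeff_rescale, sInvSeries, coeff_mk, coeff_expSeries, Nat.cast_choose ℂ hj']
  have h1 : ((k + 2).toNat.factorial : ℂ) ≠ 0 := by exact_mod_cast Nat.factorial_ne_zero _
  field_simp

/-- The product of `1 / s(r z)` and the eigenvalue of the vertex operator: the factor
`a - b = r z s(r z)` cancels. -/
theorem rescale_sInvSeries_mul_vertexEigenvalue (r : ℂ) {l : ℕ} (μ : Fin l → ℕ) :
    rescale r sInvSeries * vertexEigenvalue (expSeries (r / 2)) (expSeries (-(r / 2))) μ =
      rescale r sInvSeries + C r * X * ∑ i : Fin l,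
        (expSeries (r * ((μ i : ℂ) - ((i : ℕ) + 1) + 1 / 2)) -
          expSeries (r * (-((i : ℕ) + 1 : ℂ) + 1 / 2))) := by
  set a := expSeries (r / 2) with ha
  set b := expSeries (-(r / 2)) with hb
  have hab : a * b = 1 := by rw [ha, hb, expSeries_mul, add_neg_cancel, expSeries_zero]
  have hV : rescale r sInvSeries * (a - b) = C r * X := by
    have h1 := congrArg (rescale r) X_mul_sSeries
    have h2 := congrArg (rescale r) sInvSeries_mul_sSeries
    rw [map_mul, rescale_X, map_sub, rescale_rescale, rescale_rescale] at h1
    rw [map_mul, map_one] at h2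
    have h3 : a - b = C r * X * rescale r sSeries := by
      rw [h1, ha, hb, expSeries, expSeries]
      congr 3 <;> ring
    rw [h3]
    linear_combination (C r * X) * h2
  have h1 : ∀ i : Fin l, expSeries (r * ((μ i : ℂ) - ((i : ℕ) + 1) + 1 / 2)) =
      a ^ (2 * μ i) * b ^ (2 * (i : ℕ)) * b := by
    intro i
    rw [ha, hb, expSeries_pow, expSeries_pow, expSeries_mul, expSeries_mul]
    congr 1
    push_cast
    ring
  have h2 : ∀ i : ℕ, expSeries (r * (-((i : ℕ) + 1 : ℂ) + 1 / 2)) = b ^ (2 * i) * b := by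
    intro i
    rw [hb, expSeries_pow, expSeries_mul]
    congr 1
    push_cast
    ring
  have hgeom : ∀ n : ℕ, 1 - b ^ (2 * n) = (a - b) * ∑ i ∈ Finset.range n, b ^ (2 * i) * b := by
    intro n
    induction n with
    | zero => simp
    | succ n ih =>
      rw [Finset.sum_range_succ, Nat.mul_succ, pow_add]
      linear_combination ih - b ^ (2 * n) * hab
  have hgeom' := hgeom l
  rw [← Fin.sum_univ_eq_sum_range (fun i => b ^ (2 * i) * b)] at hgeom'
  rw [Finset.sum_sub_distrib]
  simp only [h1, h2]
  rw [vertexEigenvalue, ← hV, ← Finset.sum_mul]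
  set S := ∑ i : Fin l, a ^ (2 * μ i) * b ^ (2 * (i : ℕ))
  linear_combination (-rescale r sInvSeries) * hgeom' - (rescale r sInvSeries * S) * hab

theorem hamiltonian_schurScaled (u₀ : ℂ) {ħ r : ℂ} (hr : r ≠ 0) (hħ : r ^ 2 = ħ)
    (lam : YoungDiagram) {k : ℤ} (hk : -1 ≤ k) :
    hamiltonian u₀ ħ r k (schurScaled r lam) = eigenvalueRows u₀ r lam k • schurScaled r lam := by
  set μ : Fin (numRows lam) → ℕ := fun i => lam.rowLen i with hμ
  have h1 : hamiltonian u₀ ħ r k (schurScaled r lam) =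
      coeff (k + 2).toNat ((rescale r sSeries)⁻¹ * (expSeries u₀ *
        vertexEigenvalue (expSeries (r / 2)) (expSeries (-(r / 2))) μ)) • schurScaled r lam := by
    rw [hamiltonian, generatingH, coeff_mul, coeff_mul, LinearMap.sum_apply, Finset.sum_smul]
    refine Finset.sum_congr rfl fun p _ => ?_
    rw [coeff_map, Module.End.mul_apply, expIntegral_schurScaled u₀ hr hħ,
      Module.algebraMap_end_apply, smul_smul]
  rw [h1]
  congr 1
  rw [rescale_sSeries_inv, mul_left_comm, rescale_sInvSeries_mul_vertexEigenvalue, mul_comm, add_mul,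
    map_add, coeff_rescale_sInvSeries_mul, eigenvalueRows]
  congr 1
  have hn : (k + 2).toNat = (k + 1).toNat + 1 := by omega
  rw [mul_right_comm, mul_assoc, mul_assoc, coeff_C_mul, hn, mul_comm X,
    coeff_succ_mul_X, Finset.mul_sum, map_sum]
  congr 1
  rw [← Fin.sum_univ_eq_sum_range (fun i => ((u₀ + r * ((lam.rowLen i : ℂ) - ((i : ℂ) + 1) + 1 / 2)) ^
    (k + 1).toNat - (u₀ + r * (-((i : ℂ) + 1) + 1 / 2)) ^ (k + 1).toNat) /
      (Nat.factorial (k + 1).toNat : ℂ))]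
  refine Finset.sum_congr rfl fun i _ => ?_
  rw [mul_sub, expSeries_mul, expSeries_mul, map_sub, coeff_expSeries, coeff_expSeries, sub_div]

end Scalars

end QuantumHopf

theorem mainTheorem3 (u₀ ħ r : ℂ) (hħ : ħ ≠ 0) (hr : r ^ 2 = ħ) (lam : YoungDiagram) (k : ℤ)
    (hk : -1 ≤ k) :
    (QuantumHopf.hamiltonian u₀ ħ r k).HasEigenvector
        (QuantumHopf.eigenvalueRows u₀ r lam k) (QuantumHopf.schurScaled r lam) ∧
      QuantumHopf.eigenvalueRows u₀ r lam k = QuantumHopf.eigenvalueFrobenius u₀ r lam k := by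
  have hr0 : r ≠ 0 := by
    rintro rfl
    exact hħ (by rw [← hr]; ring)
  refine ⟨Module.End.hasEigenvector_iff.2 ⟨Module.End.mem_eigenspace_iff.2 ?_, ?_⟩, ?_⟩
  · exact QuantumHopf.hamiltonian_schurScaled u₀ hr0 hr lam hk
  · exact QuantumHopf.schurScaled_ne_zero hr0 lam
  · exact QuantumHopf.eigenvalueRows_eq_eigenvalueFrobenius u₀ r lam k
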